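/- Let $G=(V,E)$ be a finite simple graph and let $\chi\colon V\to\mathcal C\cup\{\bullet\}$ be a $k$-colouring, i.e. exactly $k$ colours of the finite set $\mathcal C$ occur as values of $\chi$; vertices with $\chi(v)=\bullet$ are called uncoloured. Let $r\colon\mathcal C\to\mathbb R_{>0}$, put $r(\bullet)=1$, and let $p\colon V\to\mathbb R^2$ satisfy $\|p(v)\|=r(\chi(v))$ for all $v\in V$; then $(G,\chi,p)$ is called a framework on $r\mathbb S^1$. Suppose that it is generic: every polynomial with rational coefficients in the coordinates of $p$ and $r$ which vanishes at $(p,r)$ lies in the ideal generated by the defining polynomials $x_v^2+y_v^2-\rho_{\chi(v)}^2$ ($v\in V$, with $\rho_\bullet=1$) of the circles. The rigidity matrix $R(G,\chi,p)$ is the matrix, with rows indexed by $E\cup V$ and columns by the coordinates of $\dot p\colon V\to\mathbb R^2$ and $\dot r\colon\mathcal C\to\mathbb R$, that has the form $\begin{pmatrix}R(G,p)&0\\ S(G,p)&V(G,\chi,p)\end{pmatrix}$. Here the row of $R(G,p)$ for an edge $uv$ has $p(u)-p(v)$ in the columns of $u$, $p(v)-p(u)$ in the columns of $v$ and zeros elsewhere;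 the row of $S(G,p)$ for a vertex $v$ has $p(v)$ in the columns of $v$ and zeros elsewhere; and the row of $V(G,\chi,p)$ for $v$ has a $1$ in the column of the colour $\chi(v)$ if $v$ is coloured, and zeros elsewhere. The framework is isostatic if the rows of $R(G,\chi,p)$ are linearly independent and $\operatorname{rank}R(G,\chi,p)=2|V|-1+\min\{k,|V|-2\}$. Then $(G,\chi,p)$ is isostatic if and only if $(G,\chi)$ is $g_1$-tight, that is, - $|E|=|V|-1+\min\{k,|V|-2\}$, and - $|F|\le |V|-\omega(F)+\min\{k(F),|V(F)|-2\}$ for every nonempty $F\subseteq E$, where $V(F)$ is the set of endpoints of the edges in $F$, $k(F)$ is the number of colours occurring in $V(F)$, and $\omega(F)$ is the number of connected components of the graph $(V,F)$, isolated vertices included. -/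

import Mathlib

namespace VariableSpheres

variable {V C : Type*}

/-- The radius prescribed by a label: `r c` for a vertex of colour `c`, and `1` for an uncoloured
vertex. A colouring is a map `χ : V → Option C`, where `none` marks the uncoloured vertices. -/
def radius (r : C → ℝ) : Option C → ℝ
  | none => 1
  | some c => r c

/-- `p` realises the coloured vertex set on the concentric `d`-spheres `r 𝕊ᵈ` in `ℝᵈ⁺¹`. -/
structure IsFramework {d : ℕ} (χ : V → Option C) (r : C → ℝ)
    (p : V → EuclideanSpace ℝ (Fin (d + 1))) : Prop where
  radius_pos : ∀ c, 0 < r c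
  mem_sphere : ∀ v, p v ∈ Metric.sphere (0 : EuclideanSpace ℝ (Fin (d + 1))) (radius r (χ v))

/-- The defining polynomial of the sphere carrying the vertex `v`; the variables are the coordinates
of the joints and the radii. -/
noncomputable def spherePoly (d : ℕ) (χ : V → Option C) (v : V) :
    MvPolynomial ((V × Fin (d + 1)) ⊕ C) ℚ :=
  (∑ i : Fin (d + 1), MvPolynomial.X (Sum.inl (v, i)) ^ 2) -
    match χ v with
    | none => 1
    | some c => MvPolynomial.X (Sum.inr c) ^ 2

/-- Every rational polynomial that vanishes at the coordinates of `p` and `r` belongs to the ideal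
generated by the defining polynomials of the spheres. -/
def IsGeneric {d : ℕ} (χ : V → Option C) (r : C → ℝ)
    (p : V → EuclideanSpace ℝ (Fin (d + 1))) : Prop :=
  ∀ f : MvPolynomial ((V × Fin (d + 1)) ⊕ C) ℚ,
    MvPolynomial.aeval (Sum.elim (fun x : V × Fin (d + 1) => p x.1 x.2) r) f = 0 →
      f ∈ Ideal.span (Set.range (spherePoly d χ))

/-- The entry of the usual rigidity matrix in the row of the edge `e = ij` and the column of the
`a`-th coordinate of `v`: `p i a - p j a` if `v = i`, `p j a - p i a` if `v = j`, else `0`. -/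
def edgeEntry [DecidableEq V] {d : ℕ} (p : V → EuclideanSpace ℝ (Fin (d + 1)))
    (e : Sym2 V) (v : V) (a : Fin (d + 1)) : ℝ :=
  Sym2.lift ⟨fun i j => (if v = i then p i a - p j a else 0) + (if v = j then p j a - p i a else 0),
    fun _ _ => add_comm _ _⟩ e

/-- The rigidity matrix `R(G, χ, p)`. Rows: edges, then vertices. Columns: coordinates of the
joints, then colours. -/
def rigidityMatrix [DecidableEq V] [DecidableEq C] {d : ℕ} (G : SimpleGraph V) (χ : V → Option C)
    (p : V → EuclideanSpace ℝ (Fin (d + 1))) :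
    Matrix (G.edgeSet ⊕ V) ((V × Fin (d + 1)) ⊕ C) ℝ :=
  Matrix.fromBlocks
    (Matrix.of fun e x => edgeEntry p e.1 x.1 x.2)
    0
    (Matrix.of fun v x => if x.1 = v then p v x.2 else 0)
    (Matrix.of fun v c => if χ v = some c then 1 else 0)

/-- The number `k` of colours in the image of `χ`. -/
noncomputable def numColours (χ : V → Option C) : ℕ := {c : C | ∃ v, χ v = some c}.ncard

/-- The rows of the rigidity matrix are linearly independent. -/
def IsIndependent [DecidableEq V] [DecidableEq C] {d : ℕ} (G : SimpleGraph V) (χ : V → Option C)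
    (p : V → EuclideanSpace ℝ (Fin (d + 1))) : Prop :=
  LinearIndependent ℝ (rigidityMatrix G χ p).row

/-- The rank of the rigidity matrix is `(d+1)n - (d+1 choose 2) + min {k, n - (d+1)}`. -/
def IsInfinitesimallyRigid [Fintype V] [DecidableEq V] [Fintype C] [DecidableEq C] {d : ℕ}
    (G : SimpleGraph V) (χ : V → Option C) (p : V → EuclideanSpace ℝ (Fin (d + 1))) : Prop :=
  ((rigidityMatrix G χ p).rank : ℤ) =
    (d + 1) * (Fintype.card V : ℤ) - ((d + 1).choose 2 : ℤ) +
      min (numColours χ : ℤ) ((Fintype.card V : ℤ) - (d + 1))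

/-- Independent and infinitesimally rigid. -/
def IsIsostatic [Fintype V] [DecidableEq V] [Fintype C] [DecidableEq C] {d : ℕ}
    (G : SimpleGraph V) (χ : V → Option C) (p : V → EuclideanSpace ℝ (Fin (d + 1))) : Prop :=
  IsIndependent G χ p ∧ IsInfinitesimallyRigid G χ p

/-- The set `V(F)` of vertices spanned by an edge set `F`. -/
def spanned (F : Set (Sym2 V)) : Set V := {v | ∃ e ∈ F, v ∈ e}

/-- The number `k(F)` of colours occurring in `V(F)`. -/
noncomputable def numColoursOf (χ : V → Option C) (F : Set (Sym2 V)) : ℕ :=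
  {c : C | ∃ v ∈ spanned F, χ v = some c}.ncard

/-- The number `ω(F)` of connected components of `(V, F)`, isolated vertices included. -/
noncomputable def numComponents (F : Set (Sym2 V)) : ℕ :=
  Nat.card (SimpleGraph.fromEdgeSet F).ConnectedComponent

/-- The count `g₁(F) = |V| - ω(F) + min {k(F), |V(F)| - 2}`. -/
noncomputable def gOne [Fintype V] (χ : V → Option C) (F : Set (Sym2 V)) : ℤ :=
  (Fintype.card V : ℤ) - (numComponents F : ℤ) +
    min (numColoursOf χ F : ℤ) (((spanned F).ncard : ℤ) - 2)

/-- `(G, χ)` is `g₁`-tight. -/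
def IsGOneTight [Fintype V] (G : SimpleGraph V) (χ : V → Option C) : Prop :=
  (G.edgeSet.ncard : ℤ) =
      (Fintype.card V : ℤ) - 1 + min (numColours χ : ℤ) ((Fintype.card V : ℤ) - 2) ∧
    ∀ F : Set (Sym2 V), F ⊆ G.edgeSet → F.Nonempty → (F.ncard : ℤ) ≤ gOne χ F

end VariableSpheres

namespace VariableSpheres

set_option linter.unusedSectionVars false

/-! A dependency between the rows of the rigidity matrix is a stress: edge weights whose resultant
at every vertex v is a radial load l(v)p(v), such that the loads of each colour add up to zero. If
only the zero stress exists, the rank is |E| + |V|, so rigidity becomes the equation for |E|. It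
remains to match independence with the counts for the edge sets F.

Necessity (`IsGeneric.le_gOne_of_isIndependent`): send weights on F to the moments of their
resultants about the origin. The ends of an edge receive opposite moments, so the image has
dimension at most |V| - ω(F). In the kernel all resultants are radial. A kernel element is
determined by its colour totals, because one with zero totals is a stress; this gives k(F). Its
loads also satisfy the two scalar equations Σ l(v)p(v) = 0; this gives |V(F)| - 2.

Sufficiency (`IsGeneric.isIndependent_of_le_gOne`): a maximal minor is a rational polynomial, so by
genericity one independent complex framework with the same colouring suffices
(`IsGeneric.isIndependent`). A submodularity argument (`IsColourSparse.uncolour`) selects at most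
one representative per colour so that the set U of representatives satisfies |E(X)| ≤ |X| + |U ∩ X|
- 1 for X nonempty and |E(X)| ≤ 2|X| - 3 for |X| ≥ 2. Vertices of equal colour still share a circle,
but loads need to balance only on the classes that meet U. This admits more stresses, so excluding
all of them is enough.

The framework is built inductively (`IsSparse.exists_stressFree`). A degree count
(`IsSparse.exists_reducible`) provides a vertex of degree at most one, a vertex of U of degree two,
a vertex of U of degree three alone in its class, or a vertex outside U of degree two that shares
its label with U. It is deleted in the first two cases, replaced by an edge in the third
(`IsSparse.exists_sup_edge`), and given a fresh label in the fourth. Apart from the first case,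
which is a direct computation, the step is reversed by virtual work: linear duality supplies a
motion along which the work of a unit stress at the vertex is a quadratic function of its position,
not identically zero on the permitted curve. At almost every point of the curve the vertex then
carries no stress. The hardest reversal is `StressFree.exists_relabel`.

Isotropic coordinates make the squared radius the product of the coordinates, so that circles have
rational parametrisations. -/

/-- The graph `G` without the edges at `v`. -/
def del {V : Type*} (G : SimpleGraph V) (v : V) : SimpleGraph V where
  Adj a b := G.Adj a b ∧ a ≠ v ∧ b ≠ v
  symm := ⟨fun _ _ h => ⟨h.1.symm, h.2.2, h.2.1⟩⟩
  loopless := ⟨fun _ h => h.1.ne rfl⟩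

/-! ### Stresses, motions and their duality. -/

section Stresses

variable {V L K : Type*} [Fintype V] [DecidableEq L] [Field K]

/-- The determinant of two plane vectors. -/
def cross (s t : K × K) : K := s.1 * t.2 - s.2 * t.1

/-- The standard bilinear form on the plane. -/
def dot (s t : K × K) : K := s.1 * t.1 + s.2 * t.2

/-- The squared radius of a point in isotropic coordinates. -/
def norm2 (s : K × K) : K := s.1 * s.2

/-- Edge weights `ω` on `G` whose resultant at every vertex `v` is the radial load `l v • p v`. -/
structure IsStress (S : Finset V) (G : SimpleGraph V) (p : V → K × K) (ω : V → V → K)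
    (l : V → K) : Prop where
  symm : ∀ u v, ω u v = ω v u
  supp : ∀ u v, ¬ G.Adj u v → ω u v = 0
  load_supp : ∀ v, v ∉ S → l v = 0
  equil : ∀ v, ∑ u, ω u v • (p u - p v) = l v • p v

/-- The loads add up to zero on every label class that meets `U`. -/
def IsBalanced (U : Finset V) (ρ : V → L) (l : V → K) : Prop :=
  ∀ u ∈ U, ∑ v, (if ρ v = ρ u then l v else 0) = 0

/-- The only stress with balanced loads is zero. -/
def StressFree (S : Finset V) (G : SimpleGraph V) (U : Finset V) (ρ : V → L)
    (p : V → K × K) : Prop :=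
  ∀ ω l, IsStress S G p ω l → IsBalanced U ρ l → ∀ u v, ω u v = 0

/-- The rate of change of the squared radius of `x`, given those of the classes of `U`. -/
def radial (U : Finset V) (ρ : V → L) (τ : V → K) (x : V) : K :=
  ∑ u ∈ U, if ρ x = ρ u then τ u else 0

/-- Infinitesimal motions of a framework whose label classes in `U` have variable radius. -/
structure IsMotion (S : Finset V) (G : SimpleGraph V) (U : Finset V) (ρ : V → L)
    (p : V → K × K) (m : V → K × K) (τ : V → K) : Prop where
  edge : ∀ x y, G.Adj x y → dot (p x - p y) (m x - m y) = 0
  vertex : ∀ x ∈ S, dot (p x) (m x) = radial U ρ τ x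

lemma dot_sum {ι : Type*} (s : Finset ι) (f : ι → K × K) (t : K × K) :
    dot (∑ i ∈ s, f i) t = ∑ i ∈ s, dot (f i) t := by
  simp [dot, Prod.fst_sum, Prod.snd_sum, Finset.sum_mul, Finset.sum_add_distrib]

lemma dot_smul (c : K) (s t : K × K) : dot (c • s) t = c * dot s t := by
  simp [dot]; ring

/-- Interchanging the sums turns the work of the loads against the class rates into class totals;
this is where balance enters. -/
lemma sum_mul_radial (U : Finset V) (ρ : V → L) (τ l : V → K) :
    ∑ x, l x * radial U ρ τ x = ∑ u ∈ U, τ u * ∑ x, (if ρ x = ρ u then l x else 0) := by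
  simp only [radial, Finset.mul_sum]
  rw [Finset.sum_comm]
  refine Finset.sum_congr rfl fun u _ => Finset.sum_congr rfl fun x _ => ?_
  split_ifs <;> ring

/-- The equilibrium conditions in weak form. -/
lemma equil_iff (p : V → K × K) (ω : V → V → K) (l : V → K) :
    (∀ v, ∑ u, ω u v • (p u - p v) = l v • p v) ↔
      ∀ m : V → K × K, ∑ x, ∑ u, ω u x * dot (p u - p x) (m x) = ∑ x, l x * dot (p x) (m x) := by
  classical
  constructor
  · intro h m
    refine Finset.sum_congr rfl fun x _ => ?_
    rw [← dot_smul, ← h x, dot_sum]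
    simp only [dot_smul]
  · intro h v
    have key : ∀ t : K × K, dot (∑ u, ω u v • (p u - p v)) t = dot (l v • p v) t := by
      intro t
      have := h (Pi.single v t)
      have e1 : ∑ x, l x * dot (p x) ((Pi.single v t : V → K × K) x) = l v * dot (p v) t := by
        rw [Finset.sum_eq_single v (by intro b _ hb; simp [hb, dot]) (by simp), Pi.single_eq_same]
      rw [e1, Finset.sum_eq_single v (by intro b _ hb; simp [Pi.single_eq_of_ne hb, dot])
        (by simp)] at this
      simpa only [dot_sum, dot_smul, Pi.single_eq_same] using this
    have h1 := key (1, 0)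
    have h2 := key (0, 1)
    simp only [dot, mul_one, mul_zero, add_zero, zero_add] at h1 h2
    exact Prod.ext h1 h2

/-- A functional that kills all motions is the virtual work of a system of weights and loads. -/
lemma exists_weights_of_forall_motion (S : Finset V) (G : SimpleGraph V) (U : Finset V) (ρ : V → L)
    (p : V → K × K) (r : ((V → K × K) × (V → K)) →ₗ[K] K)
    (hr : ∀ m τ, IsMotion S G U ρ p m τ → r (m, τ) = 0) :
    ∃ (ω : V → V → K) (l : V → K), (∀ u v, ω u v = ω v u) ∧ (∀ u v, ¬ G.Adj u v → ω u v = 0) ∧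
      (∀ v, v ∉ S → l v = 0) ∧ ∀ m τ, r (m, τ) = ∑ x, ∑ u, ω u x * dot (p u - p x) (m x)
        - ∑ x, l x * dot (p x) (m x) + ∑ x, l x * radial U ρ τ x := by
  classical
  let edgeRow : V × V → ((V → K × K) × (V → K)) →ₗ[K] K := fun e =>
    { toFun := fun q => if G.Adj e.1 e.2 then dot (p e.1 - p e.2) (q.1 e.1 - q.1 e.2) else 0
      map_add' := by intro a b; split_ifs <;> simp [dot] <;> ring
      map_smul' := by intro a b; split_ifs <;> simp [dot]; ring }
  let vertexRow : V → ((V → K × K) × (V → K)) →ₗ[K] K := fun x =>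
    { toFun := fun q => if x ∈ S then dot (p x) (q.1 x) - radial U ρ q.2 x else 0
      map_add' := by
        intro a b
        have : radial U ρ (a.2 + b.2) x = radial U ρ a.2 x + radial U ρ b.2 x := by
          simp only [radial, ← Finset.sum_add_distrib]
          exact Finset.sum_congr rfl fun u _ => by split_ifs <;> simp
        split_ifs
        · simp only [Prod.snd_add, this]; simp [dot]; ring
        · simp
      map_smul' := by
        intro a b
        have : radial U ρ (a • b.2) x = a * radial U ρ b.2 x := by
          simp only [radial, Finset.mul_sum]
          exact Finset.sum_congr rfl fun u _ => by split_ifs <;> simp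
        split_ifs
        · simp only [Prod.smul_snd, this]; simp [dot]; ring
        · simp }
  -- Linear duality: a functional that vanishes on the common kernel of finitely many functionals is
  -- a combination of them.
  have hmem : r ∈ Submodule.span K (Set.range (Sum.elim edgeRow vertexRow)) := by
    refine mem_span_of_iInf_ker_le_ker fun q hq => ?_
    simp only [Submodule.mem_iInf, LinearMap.mem_ker] at hq ⊢
    refine hr q.1 q.2 ⟨fun x y hxy => ?_, fun x hx => ?_⟩
    · have := hq (Sum.inl (x, y))
      simpa [edgeRow, hxy] using this
    · have := hq (Sum.inr x)
      simpa [vertexRow, hx, sub_eq_zero] using this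
  obtain ⟨c, hc⟩ := (Submodule.mem_span_range_iff_exists_fun K).1 hmem
  -- The edge rows are indexed by ordered pairs, so a weight collects both orientations. The sign
  -- appears because the force at v is written with `p u - p v`.
  refine ⟨fun u v => if G.Adj u v then -(c (Sum.inl (u, v)) + c (Sum.inl (v, u))) else 0,
    fun x => if x ∈ S then -c (Sum.inr x) else 0, ?_, ?_, ?_, ?_⟩
  · intro u v; simp only [G.adj_comm u v, add_comm]
  · intro u v h; simp [h]
  · intro v h; simp [h]
  · intro m τ
    have h1 : r (m, τ) = (∑ x, ∑ y, c (Sum.inl (x, y)) *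
          (if G.Adj x y then dot (p x - p y) (m x - m y) else 0)) +
        ∑ x, c (Sum.inr x) * (if x ∈ S then dot (p x) (m x) - radial U ρ τ x else 0) := by
      rw [← hc]
      simp only [Fintype.sum_sum_type, LinearMap.add_apply, LinearMap.sum_apply,
        LinearMap.smul_apply, Sum.elim_inl, Sum.elim_inr, smul_eq_mul, Fintype.sum_prod_type]
      rfl
    rw [h1]
    have h2 : (∑ x, ∑ y, c (Sum.inl (x, y)) *
          (if G.Adj x y then dot (p x - p y) (m x - m y) else 0)) =
        ∑ x, ∑ u, (if G.Adj u x then -(c (Sum.inl (u, x)) + c (Sum.inl (x, u))) else 0) *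
          dot (p u - p x) (m x) := by
      have e1 : ∀ x y, c (Sum.inl (x, y)) *
          (if G.Adj x y then dot (p x - p y) (m x - m y) else 0) =
          (if G.Adj x y then c (Sum.inl (x, y)) * dot (p x - p y) (m x) else 0) +
          (if G.Adj x y then c (Sum.inl (x, y)) * dot (p y - p x) (m y) else 0) := by
        intro x y; split_ifs <;> simp [dot]; ring
      simp only [e1, Finset.sum_add_distrib]
      rw [Finset.sum_comm (f := fun x y =>
        if G.Adj x y then c (Sum.inl (x, y)) * dot (p y - p x) (m y) else 0)]
      simp only [← Finset.sum_add_distrib]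
      refine Finset.sum_congr rfl fun x _ => Finset.sum_congr rfl fun y _ => ?_
      rw [G.adj_comm x y]
      split_ifs <;> simp [dot]; ring
    rw [h2, sub_add, ← Finset.sum_sub_distrib, sub_eq_add_neg, ← Finset.sum_neg_distrib]
    congr 1
    refine Finset.sum_congr rfl fun x _ => ?_
    by_cases hx : x ∈ S
    · simp only [if_pos hx]; ring
    · simp only [if_neg hx]; ring

/-- The virtual work of a balanced stress along a motion of the framework without `v`. -/
lemma IsStress.virtual_work [CharZero K] {S : Finset V} [DecidableEq V] {G : SimpleGraph V}
    {U : Finset V} {ρ : V → L} {p m : V → K × K} {ω : V → V → K} {l τ : V → K} {v : V}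
    (hs : IsStress S G p ω l) (hb : IsBalanced U ρ l)
    (hm : IsMotion (S.erase v) (del G v) U ρ p m τ) :
    ∑ x, ω x v * dot (p v - p x) (m x) + l v * radial U ρ τ v = 0 := by
  -- With `v` held still, the missing work of its load turns up on the right-hand side, and only the
  -- edges at `v` can do work.
  set m' := Function.update m v 0 with hm'
  have h0 : dot (p v) (m' v) = 0 := by simp [hm', dot]
  have hne : ∀ x, x ≠ v → m' x = m x := fun x hx => by simp [hm', hx]
  have hw := (equil_iff p ω l).1 hs.equil m'
  have hR : ∑ x, l x * dot (p x) (m' x) = - (l v * radial U ρ τ v) := by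
    have e : ∀ x, l x * dot (p x) (m' x) =
        l x * radial U ρ τ x - if x = v then l v * radial U ρ τ v else 0 := by
      intro x
      by_cases hx : x = v
      · subst hx; simp [h0]
      · rw [hne x hx, if_neg hx, sub_zero]
        by_cases hxS : x ∈ S
        · rw [hm.vertex x (Finset.mem_erase.2 ⟨hx, hxS⟩)]
        · simp [hs.load_supp x hxS]
    simp only [e, Finset.sum_sub_distrib, sum_mul_radial]
    rw [Finset.sum_eq_zero fun u hu => by rw [hb u hu, mul_zero]]
    simp
  have hL : ∑ x, ∑ u, ω u x * dot (p u - p x) (m' x) = ∑ x, ω x v * dot (p v - p x) (m x) := by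
    have e : ∀ x u, ω u x * dot (p u - p x) (m' x) =
        (if u = v then ω v x * dot (p v - p x) (m' x) else 0) +
        if u = v then 0 else ω u x * dot (p u - p x) (m' x) := by
      intro x u; split_ifs with h <;> simp [h]
    rw [Finset.sum_congr rfl fun x _ => Finset.sum_congr rfl fun u _ => e x u]
    simp only [Finset.sum_add_distrib]
    set T := ∑ x, ∑ u, if u = v then 0 else ω u x * dot (p u - p x) (m' x) with hT
    -- Swapping the indices exchanges the ends of each edge. The motion preserves lengths away from
    -- `v`, so the total work of those edges is its own negative.
    have hanti : T = -T := by
      conv_lhs => rw [hT, Finset.sum_comm]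
      rw [hT, ← Finset.sum_neg_distrib]
      refine Finset.sum_congr rfl fun x _ => ?_
      rw [← Finset.sum_neg_distrib]
      refine Finset.sum_congr rfl fun u _ => ?_
      by_cases hx : x = v
      · subst hx
        by_cases hu : u = x
        · simp [hu]
        · simp [hu, hm', dot]
      · by_cases hu : u = v
        · subst hu; simp [hx, hm', dot]
        · rw [if_neg hx, if_neg hu, hs.symm x u, hne u hu, hne x hx]
          by_cases hadj : G.Adj u x
          · have := hm.edge u x ⟨hadj, hu, hx⟩
            have h2 : dot (p x - p u) (m u) = - dot (p u - p x) (m x) := by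
              simp only [dot, Prod.fst_sub, Prod.snd_sub] at this ⊢
              linear_combination -this
            rw [h2]; ring
          · simp [hs.supp u x hadj]
    have hT0 : T = 0 := by
      have : (2 : K) * T = 0 := by linear_combination hanti
      simpa using this
    rw [hT0, add_zero]
    refine Finset.sum_congr rfl fun x _ => ?_
    rw [Finset.sum_ite_eq' Finset.univ v]
    by_cases hx : x = v
    · subst hx; simp [dot]
    · simp [hne x hx, hs.symm v x]
  rw [← hL, hw, hR]; ring

/-- A stress that vanishes at `v` does not depend on the position of `v`. -/
lemma IsStress.transfer {S S' : Finset V} {G G' : SimpleGraph V} {p p' : V → K × K}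
    {ω : V → V → K} {l : V → K} {v : V} (hs : IsStress S G p ω l) (hv : ∀ x, ω x v = 0)
    (hl : l v = 0) (hp : ∀ x, x ≠ v → p' x = p x)
    (hG : ∀ x y, x ≠ v → y ≠ v → G.Adj x y → G'.Adj x y) (hS : ∀ x ∈ S, x ≠ v → x ∈ S') :
    IsStress S' G' p' ω l where
  symm := hs.symm
  supp a b h := by
    by_cases ha : a = v
    · rw [ha, hs.symm, hv]
    · by_cases hb : b = v
      · rw [hb, hv]
      · exact hs.supp a b fun h' => h (hG a b ha hb h')
  load_supp a h := by
    by_cases ha : a = v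
    · rw [ha, hl]
    · exact hs.load_supp a fun h' => h (hS a h' ha)
  equil a := by
    by_cases ha : a = v
    · subst ha; simp [hv, hl]
    · rw [hp a ha, ← hs.equil a]
      refine Finset.sum_congr rfl fun u _ => ?_
      by_cases hu : u = v
      · rw [hu, hs.symm v a, hv]; simp
      · rw [hp u hu]

/-- A vertex without stress has zero resultant, and its position is nonzero if a load is allowed
there. -/
lemma IsStress.load_eq_zero {S : Finset V} {G : SimpleGraph V} {p : V → K × K} {ω : V → V → K}
    {l : V → K} {v : V} (hs : IsStress S G p ω l) (hv : ∀ x, ω x v = 0)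
    (hp : v ∈ S → norm2 (p v) ≠ 0) : l v = 0 := by
  by_cases hvS : v ∈ S
  · have h := hs.equil v
    simp only [hv, zero_smul, Finset.sum_const_zero] at h
    rcases smul_eq_zero.1 h.symm with h | h
    · exact h
    · exact absurd (by simp [norm2, h]) (hp hvS)
  · exact hs.load_supp v hvS

lemma IsStress.add_smul {S : Finset V} {G : SimpleGraph V} {p : V → K × K} {ω ω' : V → V → K}
    {l l' : V → K} (hs : IsStress S G p ω l) (hs' : IsStress S G p ω' l') (c : K) :
    IsStress S G p (fun u v => ω u v + c * ω' u v) (fun v => l v + c * l' v) where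
  symm a b := by rw [hs.symm, hs'.symm]
  supp a b h := by rw [hs.supp a b h, hs'.supp a b h]; ring
  load_supp a h := by rw [hs.load_supp a h, hs'.load_supp a h]; ring
  equil a := by
    simp only [_root_.add_smul, Finset.sum_add_distrib, hs.equil a, mul_smul, ← Finset.smul_sum,
      hs'.equil a]

end Stresses

/-! ### General position on circles and on a cubic curve. -/

section Placement

variable {V L K : Type*} [Field K]

/-- The joints of `S` have distinct directions, no three are collinear, and their squared radii are
nonzero and separate the labels. -/
structure IsAdmissible (S : Finset V) (ρ : V → L) (p : V → K × K) : Prop where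
  cross_ne : ∀ u ∈ S, ∀ v ∈ S, u ≠ v → cross (p u) (p v) ≠ 0
  not_collinear : ∀ u ∈ S, ∀ v ∈ S, ∀ w ∈ S, u ≠ v → u ≠ w → v ≠ w →
    cross (p v - p u) (p w - p u) ≠ 0
  norm_ne : ∀ u ∈ S, norm2 (p u) ≠ 0
  norm_eq : ∀ u ∈ S, ∀ v ∈ S, norm2 (p u) = norm2 (p v) ↔ ρ u = ρ v

/-- A polynomial function of degree two on the plane. -/
def quad (c a b d e f : K) (s : K × K) : K :=
  c + a * s.1 + b * s.2 + d * s.1 ^ 2 + e * (s.1 * s.2) + f * s.2 ^ 2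

/-- A nonzero polynomial has finitely many roots. Stated with the cofinite filter, finitely many
such conditions on one parameter combine, and over an infinite field they can be met. -/
lemma eventually_sum_mul_pow_ne_zero {n : ℕ} (c : Fin n → K) (hc : c ≠ 0) :
    ∀ᶠ z in Filter.cofinite, ∑ j, c j * z ^ (j : ℕ) ≠ 0 := by
  classical
  set P : Polynomial K := ∑ j, Polynomial.C (c j) * Polynomial.X ^ (j : ℕ) with hP
  have hP0 : P ≠ 0 := by
    obtain ⟨i, hi⟩ := Function.ne_iff.1 hc
    intro h
    apply hi
    have h1 : P.coeff i = c i := by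
      rw [hP, Polynomial.finsetSum_coeff, Finset.sum_eq_single i]
      · simp
      · intro b _ hb
        have : (i : ℕ) ≠ b := fun h => hb (Fin.ext h.symm)
        simp [Polynomial.coeff_X_pow, this]
      · simp
    rw [Pi.zero_apply, ← h1, h, Polynomial.coeff_zero]
  have hfin := Polynomial.finite_setOfPred_isRoot hP0
  refine hfin.subset fun z hz => ?_
  simp only [Set.mem_compl_iff, Set.mem_ofPred_eq, not_not] at hz
  simpa [hP, Polynomial.IsRoot, Polynomial.eval_finsetSum] using hz

/-- The hyperbola of points of squared radius `R`. -/
def circlePoint (R z : K) : K × K := (z, R / z)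

lemma circlePoint_norm {R z : K} (hz : z ≠ 0) : norm2 (circlePoint R z) = R := by
  simp [norm2, circlePoint]; field_simp

/-- Multiplication by z² gives a polynomial of degree at most four in z. For nonzero `R` the
excluded case says that the quadratic function is a multiple of `s.1 * s.2 - R`. -/
lemma eventually_circle_quad_ne_zero {R : K} {c a b d e f : K}
    (h : ¬ (a = 0 ∧ b * R = 0 ∧ d = 0 ∧ c + e * R = 0 ∧ f * R ^ 2 = 0)) :
    ∀ᶠ z in Filter.cofinite, quad c a b d e f (circlePoint R z) ≠ 0 := by
  have h1 := eventually_sum_mul_pow_ne_zero ![f * R ^ 2, b * R, c + e * R, a, d] (by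
    intro h0
    apply h
    have e0 := congrFun h0 0
    have e1 := congrFun h0 1
    have e2 := congrFun h0 2
    have e3 := congrFun h0 3
    have e4 := congrFun h0 4
    simp only [Fin.isValue, Pi.zero_apply] at e0 e1 e2 e3 e4
    exact ⟨e3, e1, e4, e2, e0⟩)
  have h2 : ∀ᶠ z : K in Filter.cofinite, z ≠ 0 := by simp
  filter_upwards [h1, h2] with z hz hz0 hq
  apply hz
  simp only [Fin.sum_univ_five]
  simp only [quad, circlePoint] at hq
  field_simp at hq
  simp
  linear_combination hq

/-- A cubic curve on which no quadratic function vanishes identically. -/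
def cubicPoint (z : K) : K × K := (z, z ^ 3)

/-- Along the cubic, the six monomials of degree at most two become the distinct powers 0, 1, 2, 3,
4 and 6 of the parameter. -/
lemma eventually_cubic_quad_ne_zero {c a b d e f : K}
    (h : ¬ (c = 0 ∧ a = 0 ∧ b = 0 ∧ d = 0 ∧ e = 0 ∧ f = 0)) :
    ∀ᶠ z in Filter.cofinite, quad c a b d e f (cubicPoint z) ≠ 0 := by
  have h1 := eventually_sum_mul_pow_ne_zero ![c, a, d, b, e, 0, f] (by
    intro h0
    apply h
    have e0 := congrFun h0 0
    have e1 := congrFun h0 1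
    have e2 := congrFun h0 2
    have e3 := congrFun h0 3
    have e4 := congrFun h0 4
    have e6 := congrFun h0 6
    simp only [Fin.isValue, Pi.zero_apply] at e0 e1 e2 e3 e4 e6
    exact ⟨e0, e1, e3, e2, e4, e6⟩)
  filter_upwards [h1] with z hz hq
  apply hz
  simp only [Fin.sum_univ_seven]
  simp only [quad, cubicPoint] at hq
  simp
  linear_combination hq

/-- Almost every point of a curve that is not contained in a line is an admissible position
for `v`, if its squared radius fits. -/
lemma eventually_isAdmissible_update [DecidableEq V] {S : Finset V} {ρ : V → L} {p : V → K × K} {v : V}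
    (hp : IsAdmissible (S.erase v) ρ p) (γ : K → K × K)
    (hγ : ∀ a b c : K, ¬ (a = 0 ∧ b = 0) →
      ∀ᶠ z in Filter.cofinite, c + a * (γ z).1 + b * (γ z).2 ≠ 0)
    (hn : ∀ᶠ z in Filter.cofinite, norm2 (γ z) ≠ 0 ∧
      ∀ u ∈ S.erase v, norm2 (p u) = norm2 (γ z) ↔ ρ u = ρ v) :
    ∀ᶠ z in Filter.cofinite, IsAdmissible S ρ (Function.update p v (γ z)) := by
  have h1 : ∀ᶠ z in Filter.cofinite, ∀ u ∈ S.erase v, cross (p u) (γ z) ≠ 0 := by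
    rw [Filter.eventually_all_finset]
    intro u hu
    have h0 : ¬ ((-(p u).2) = 0 ∧ (p u).1 = 0) := by
      rintro ⟨-, h⟩
      exact hp.norm_ne u hu (by simp [norm2, h])
    filter_upwards [hγ _ _ 0 h0] with z hz h
    apply hz
    simp only [cross] at h
    linear_combination h
  have h2 : ∀ᶠ z in Filter.cofinite, ∀ u ∈ S.erase v, ∀ w ∈ S.erase v, u ≠ w →
      cross (p w - p u) (γ z - p u) ≠ 0 := by
    rw [Filter.eventually_all_finset]
    intro u hu
    rw [Filter.eventually_all_finset]
    intro w hw
    by_cases huw : u = w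
    · simp [huw]
    have h0 : ¬ (((p u).2 - (p w).2) = 0 ∧ (p w).1 - (p u).1 = 0) := by
      rintro ⟨h, h'⟩
      apply hp.cross_ne u hu w hw huw
      simp only [cross]
      linear_combination -(p w).1 * h - (p w).2 * h'
    filter_upwards [hγ _ _ ((p w).2 * (p u).1 - (p w).1 * (p u).2) h0] with z hz _ h
    apply hz
    simp only [cross, Prod.fst_sub, Prod.snd_sub] at h
    linear_combination h
  filter_upwards [h1, h2, hn] with z c1 c2 ⟨c3, c4⟩
  have hv : Function.update p v (γ z) v = γ z := by simp
  have hne : ∀ u, u ≠ v → Function.update p v (γ z) u = p u := fun u hu => by simp [hu]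
  have hsub : ∀ u ∈ S, u ≠ v → u ∈ S.erase v := fun u hu h => Finset.mem_erase.2 ⟨h, hu⟩
  have anti : ∀ a b : K × K, cross a b = - cross b a := fun a b => by simp only [cross]; ring
  refine ⟨?_, ?_, ?_, ?_⟩
  · intro u hu w hw huw
    by_cases hu' : u = v
    · subst hu'
      rw [hv, hne w huw.symm, anti]
      exact neg_ne_zero.2 (c1 w (hsub w hw huw.symm))
    · by_cases hw' : w = v
      · subst hw'
        rw [hv, hne u huw]
        exact c1 u (hsub u hu huw)
      · rw [hne u hu', hne w hw']
        exact hp.cross_ne u (hsub u hu hu') w (hsub w hw hw') huw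
  · intro u hu w hw x hx huw hux hwx
    by_cases hu' : u = v
    · subst hu'
      rw [hv, hne w huw.symm, hne x hux.symm]
      have := c2 w (hsub w hw huw.symm) x (hsub x hx hux.symm) hwx
      intro h; apply this
      simp only [cross, Prod.fst_sub, Prod.snd_sub] at h ⊢
      linear_combination h
    · by_cases hw' : w = v
      · subst hw'
        rw [hv, hne u huw, hne x hwx.symm]
        have := c2 u (hsub u hu huw) x (hsub x hx hwx.symm) hux
        intro h; apply this
        simp only [cross, Prod.fst_sub, Prod.snd_sub] at h ⊢
        linear_combination -h
      · by_cases hx' : x = v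
        · subst hx'
          rw [hv, hne u hux, hne w hwx]
          exact c2 u (hsub u hu hux) w (hsub w hw hwx) huw
        · rw [hne u hu', hne w hw', hne x hx']
          exact hp.not_collinear u (hsub u hu hu') w (hsub w hw hw') x (hsub x hx hx') huw hux hwx
  · intro u hu
    by_cases hu' : u = v
    · subst hu'; rwa [hv]
    · rw [hne u hu']; exact hp.norm_ne u (hsub u hu hu')
  · intro u hu w hw
    by_cases hu' : u = v
    · subst hu'
      by_cases hw' : w = u
      · subst hw'; simp
      · rw [hv, hne w hw', eq_comm, c4 w (hsub w hw hw'), eq_comm]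
    · by_cases hw' : w = v
      · subst hw'
        rw [hv, hne u hu', c4 u (hsub u hu hu')]
      · rw [hne u hu', hne w hw']
        exact hp.norm_eq u (hsub u hu hu') w (hsub w hw hw')

/-- The label of `v` determines a squared radius compatible with the other joints. -/
lemma IsAdmissible.exists_radius [CharZero K] {S : Finset V} {ρ : V → L} {p : V → K × K}
    (hp : IsAdmissible S ρ p) (v : V) :
    ∃ R : K, R ≠ 0 ∧ ∀ u ∈ S, norm2 (p u) = R ↔ ρ u = ρ v := by
  classical
  by_cases h : ∃ w ∈ S, ρ w = ρ v
  · obtain ⟨w, hw, hwv⟩ := h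
    exact ⟨norm2 (p w), hp.norm_ne w hw, fun u hu => by rw [hp.norm_eq u hu w hw, hwv]⟩
  · push Not at h
    obtain ⟨R, hR⟩ := Infinite.exists_notMem_finset (insert 0 (S.image fun u => norm2 (p u)))
    simp only [Finset.mem_insert, Finset.mem_image, not_or, not_exists, not_and] at hR
    exact ⟨R, hR.1, fun u hu => iff_of_false (hR.2 u hu) (h u hu)⟩

lemma eventually_circle_isAdmissible [DecidableEq V] {S : Finset V} {ρ : V → L} {p : V → K × K} {v : V}
    (hp : IsAdmissible (S.erase v) ρ p) {R : K} (hR : R ≠ 0)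
    (hRv : ∀ u ∈ S.erase v, norm2 (p u) = R ↔ ρ u = ρ v) :
    ∀ᶠ z in Filter.cofinite, IsAdmissible S ρ (Function.update p v (circlePoint R z)) := by
  refine eventually_isAdmissible_update hp _ (fun a b c h => ?_) ?_
  · have := eventually_circle_quad_ne_zero (R := R) (c := c) (a := a) (b := b) (d := 0) (e := 0)
      (f := 0) (by rintro ⟨h1, h2, -⟩; exact h ⟨h1, (mul_eq_zero.1 h2).resolve_right hR⟩)
    filter_upwards [this] with z hz
    simpa [quad] using hz
  · have h2 : ∀ᶠ z : K in Filter.cofinite, z ≠ 0 := by simp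
    filter_upwards [h2] with z hz
    rw [circlePoint_norm hz]
    exact ⟨hR, hRv⟩

lemma eventually_cubic_isAdmissible [DecidableEq V] {S : Finset V} {ρ : V → L} {p : V → K × K} {v : V}
    (hp : IsAdmissible (S.erase v) ρ p) (hv : ∀ u ∈ S.erase v, ρ u ≠ ρ v) :
    ∀ᶠ z in Filter.cofinite, IsAdmissible S ρ (Function.update p v (cubicPoint z)) := by
  refine eventually_isAdmissible_update hp _ (fun a b c h => ?_) ?_
  · have := eventually_cubic_quad_ne_zero (c := c) (a := a) (b := b) (d := 0) (e := 0)
      (f := 0) (by rintro ⟨-, h1, h2, -⟩; exact h ⟨h1, h2⟩)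
    filter_upwards [this] with z hz
    simpa [quad] using hz
  · have h2 : ∀ᶠ z : K in Filter.cofinite, ∀ u ∈ S.erase v, norm2 (p u) ≠ norm2 (cubicPoint z) := by
      rw [Filter.eventually_all_finset]
      intro u hu
      have := eventually_cubic_quad_ne_zero (c := norm2 (p u)) (a := 0) (b := 0) (d := 0)
        (e := -1) (f := 0) (by simp)
      filter_upwards [this] with z hz h
      apply hz
      rw [h]; simp [quad, norm2]
    have h3 : ∀ᶠ z : K in Filter.cofinite, z ≠ 0 := by simp
    filter_upwards [h2, h3] with z hz hz0
    refine ⟨by simp [norm2, cubicPoint, hz0], fun u hu => iff_of_false (hz u hu) (hv u hu)⟩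

end Placement

/-! ### Adding vertices of degree one and two. -/

section Moves

variable {V L K : Type*} [Fintype V] [DecidableEq V] [DecidableEq L] [Field K]

lemma radial_congr {U : Finset V} {ρ : V → L} {τ : V → K} {x y : V} (h : ρ x = ρ y) :
    radial U ρ τ x = radial U ρ τ y := by
  simp only [radial, h]

lemma radial_eq_of_injOn {U : Finset V} {ρ : V → L} {τ : V → K} (hinj : Set.InjOn ρ U) {u : V}
    (hu : u ∈ U) : radial U ρ τ u = τ u := by
  rw [radial, Finset.sum_eq_single u]
  · simp
  · intro w hw hwu
    exact if_neg fun h => hwu (hinj hw hu h.symm)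
  · exact fun h => absurd hu h

/-- A stress-free framework whose class of `u` is fixed moves when that class is released. -/
lemma StressFree.exists_motion_radial_ne {S : Finset V} {G : SimpleGraph V} {U : Finset V}
    {ρ : V → L} {p : V → K × K} {u : V} (hu : u ∈ U) (hinj : Set.InjOn ρ U)
    (hp : ∀ v ∈ S, norm2 (p v) ≠ 0) (h : StressFree S G (U.erase u) ρ p) :
    ∃ m τ, IsMotion S G U ρ p m τ ∧ radial U ρ τ u ≠ 0 := by
  -- If every motion fixed the radius of this class, its rate would be the virtual work of a stress
  -- with total load one on the class of `u` and zero on the other classes of `U`. Such a stress is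
  -- balanced once `u` is removed from `U`.
  by_contra! hcon
  obtain ⟨ω, l, h1, h2, h3, h4⟩ := exists_weights_of_forall_motion S G U ρ p
    ((LinearMap.proj u).comp (LinearMap.snd K _ _)) (fun m τ hm => by
      have := hcon m τ hm
      rw [radial_eq_of_injOn hinj hu] at this
      simpa using this)
  have h4' : ∀ (m : V → K × K) (τ : V → K), τ u = ∑ x, ∑ u, ω u x * dot (p u - p x) (m x)
        - ∑ x, l x * dot (p x) (m x) + ∑ x, l x * radial U ρ τ x := fun m τ => h4 m τ
  have hs : IsStress S G p ω l := ⟨h1, h2, h3, (equil_iff p ω l).2 fun m => by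
    have := h4' m 0
    simp only [radial, Pi.zero_apply, ite_self, Finset.sum_const_zero, mul_zero, add_zero] at this
    exact (sub_eq_zero.1 this.symm)⟩
  have hb : ∀ w ∈ U, ∑ x, (if ρ x = ρ w then l x else 0) = if w = u then 1 else 0 := by
    intro w hw
    have := h4' 0 (Pi.single w 1)
    simp only [dot, Pi.zero_apply, Prod.fst_zero, Prod.snd_zero, mul_zero, add_zero,
      Finset.sum_const_zero, sub_self, zero_add, sum_mul_radial] at this
    rw [Finset.sum_eq_single w (by intro b _ hb; simp [hb]) (fun h => absurd hw h)] at this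
    simp only [Pi.single_eq_same, one_mul] at this
    rw [← this, Pi.single_apply]
    simp only [eq_comm]
  have hω := h ω l hs (fun w hw => by
    rw [hb w (Finset.mem_of_mem_erase hw), if_neg (Finset.ne_of_mem_erase hw)])
  have hl : ∀ v, l v = 0 := fun v => hs.load_eq_zero (fun x => hω x v) (hp v)
  have := hb u hu
  simp [hl] at this

/-- The weight that is one on the pair `xy` and zero elsewhere. -/
def unitWeight (x y a b : V) : K :=
  (if a = x ∧ b = y then 1 else 0) + if a = y ∧ b = x then 1 else 0

lemma unitWeight_comm (x y a b : V) : (unitWeight x y a b : K) = unitWeight x y b a := by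
  simp only [unitWeight, and_comm, add_comm]

lemma sum_unitWeight (p : V → K × K) (x y : V) (m : V → K × K) :
    ∑ a, ∑ u, unitWeight x y u a * dot (p u - p a) (m a) = - dot (p x - p y) (m x - m y) := by
  have e : ∀ a u, unitWeight x y u a * dot (p u - p a) (m a) =
      (if u = x then if a = y then dot (p x - p y) (m y) else 0 else 0) +
      if u = y then if a = x then dot (p y - p x) (m x) else 0 else 0 := by
    intro a u
    simp only [unitWeight]
    by_cases hux : u = x <;> by_cases hay : a = y <;> by_cases huy : u = y <;>
      by_cases hax : a = x <;> simp_all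
    ring
  simp only [e, Finset.sum_add_distrib, Finset.sum_ite_eq', Finset.mem_univ, if_true]
  simp only [dot, Prod.fst_sub, Prod.snd_sub]; ring

/-- If the edge `xy` can be added to a stress-free framework, then some motion changes its
length. -/
lemma StressFree.exists_motion_edge_ne {S : Finset V} {G : SimpleGraph V} {U : Finset V}
    {ρ : V → L} {p : V → K × K} {x y : V} (hxy : x ≠ y) (hadj : ¬ G.Adj x y)
    (h : StressFree S (G ⊔ SimpleGraph.edge x y) U ρ p) :
    ∃ m τ, IsMotion S G U ρ p m τ ∧ dot (p x - p y) (m x - m y) ≠ 0 := by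
  by_contra! hcon
  let r : ((V → K × K) × (V → K)) →ₗ[K] K :=
    { toFun := fun q => dot (p x - p y) (q.1 x - q.1 y)
      map_add' := by intro a b; simp [dot]; ring
      map_smul' := by intro a b; simp [dot]; ring }
  obtain ⟨ω, l, h1, h2, h3, h4⟩ := exists_weights_of_forall_motion S G U ρ p r hcon
  have h4' : ∀ (m : V → K × K) (τ : V → K), dot (p x - p y) (m x - m y) = ∑ x, ∑ u, ω u x * dot (p u - p x) (m x)
        - ∑ x, l x * dot (p x) (m x) + ∑ x, l x * radial U ρ τ x := fun m τ => h4 m τ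
  have hδ := sum_unitWeight (K := K) p x y
  -- A unit weight on `xy` does minus the work of the length functional, so adding it cancels the
  -- resultants. The new stress has weight one on `xy`, since `ω` is zero there.
  have hs : IsStress S (G ⊔ SimpleGraph.edge x y) p (fun a b => ω a b + unitWeight x y a b) l := by
    refine ⟨fun a b => ?_, fun a b hab => ?_, h3, (equil_iff p _ l).2 fun m => ?_⟩
    · rw [h1 a b, unitWeight_comm]
    · simp only [SimpleGraph.sup_adj, SimpleGraph.edge_adj, not_or] at hab
      rw [h2 a b hab.1]
      have h5 : ¬ (a = x ∧ b = y) := by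
        rintro ⟨rfl, rfl⟩; exact hab.2 ⟨Or.inl ⟨rfl, rfl⟩, hxy⟩
      have h6 : ¬ (a = y ∧ b = x) := by
        rintro ⟨rfl, rfl⟩; exact hab.2 ⟨Or.inr ⟨rfl, rfl⟩, hxy.symm⟩
      simp [unitWeight, h5, h6]
    · have := h4' m 0
      simp only [add_mul, Finset.sum_add_distrib, hδ, this]
      simp [radial]
  have hb : IsBalanced U ρ l := by
    intro w hw
    have := h4' 0 (Pi.single w 1)
    simp only [dot, Pi.zero_apply, Prod.fst_zero, Prod.snd_zero, mul_zero, add_zero, sub_zero,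
      Finset.sum_const_zero, zero_add, sum_mul_radial] at this
    rw [Finset.sum_eq_single w (by intro b _ hb; simp [hb]) (fun h => absurd hw h)] at this
    simpa using this.symm
  have := h _ _ hs hb x y
  simp [unitWeight, h2 x y hadj, hxy] at this

/-- The virtual work of a unit stress at a vertex `s` with neighbours `px` and `py`, up to a
factor. -/
def workTwo (px py mx my : K × K) (r : K) (s : K × K) : K :=
  cross s py * dot (s - px) mx + cross px s * dot (s - py) my +
    (cross px py - cross s py - cross px s) * r

/-- The coefficients are explicit because the placement arguments use the constant and linear ones.
-/
lemma workTwo_eq_quad (px py mx my : K × K) (r : K) (s : K × K) :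
    workTwo px py mx my r s = quad (cross px py * r)
      (-py.2 * (dot px mx + r) + px.2 * (dot py my + r))
      (py.1 * (dot px mx + r) - px.1 * (dot py my + r))
      (py.2 * mx.1 - px.2 * my.1)
      (py.2 * mx.2 - py.1 * mx.1 + px.1 * my.1 - px.2 * my.2)
      (-py.1 * mx.2 + px.1 * my.2) s := by
  simp only [workTwo, quad, cross, dot, Prod.fst_sub, Prod.snd_sub]; ring

variable [CharZero K]

/-- A vertex of degree at most two carries no stress if some virtual work there is nonzero. -/
lemma IsStress.eq_zero_of_workTwo_ne {S : Finset V} {G : SimpleGraph V}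
    {U : Finset V} {ρ : V → L} {p m : V → K × K} {ω : V → V → K} {l τ : V → K} {v x y : V}
    (hs : IsStress S G p ω l) (hb : IsBalanced U ρ l)
    (hm : IsMotion (S.erase v) (del G v) U ρ p m τ) (hxy : x ≠ y)
    (hv : ∀ a, G.Adj v a → a = x ∨ a = y) (hcr : cross (p x) (p y) ≠ 0)
    (hw : workTwo (p x) (p y) (m x) (m y) (radial U ρ τ v) (p v) ≠ 0) :
    ∀ a, ω a v = 0 := by
  have hz : ∀ a, a ≠ x → a ≠ y → ω a v = 0 := fun a h1 h2 =>
    hs.supp a v fun h => (hv a h.symm).elim h1 h2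
  have hvw := hs.virtual_work hb hm
  have heq := hs.equil v
  rw [Finset.sum_eq_add x y hxy (by rintro c - ⟨h1, h2⟩; simp [hz c h1 h2]) (by simp) (by simp)]
    at hvw heq
  have e1 := congrArg Prod.fst heq
  have e2 := congrArg Prod.snd heq
  simp only [Prod.fst_add, Prod.snd_add, Prod.smul_fst, Prod.smul_snd, Prod.fst_sub, Prod.snd_sub,
    smul_eq_mul] at e1 e2
  -- Equilibrium at `v` says ω_x p_x + ω_y p_y = λ p_v with λ = ω_x + ω_y + l_v. Cramer's rule makes
  -- both weights multiples of λ, and the virtual work then kills λ.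
  have k1 : ω x v * cross (p x) (p y) = (ω x v + ω y v + l v) * cross (p v) (p y) := by
    simp only [cross]; linear_combination (p y).2 * e1 - (p y).1 * e2
  have k2 : ω y v * cross (p x) (p y) = (ω x v + ω y v + l v) * cross (p x) (p v) := by
    simp only [cross]; linear_combination (p x).1 * e2 - (p x).2 * e1
  have k3 : (ω x v + ω y v + l v) *
      workTwo (p x) (p y) (m x) (m y) (radial U ρ τ v) (p v) = 0 := by
    simp only [workTwo]
    linear_combination cross (p x) (p y) * hvw - dot (p v - p x) (m x) * k1 -
      dot (p v - p y) (m y) * k2 + radial U ρ τ v * (k1 + k2)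
  rw [(mul_eq_zero.1 k3).resolve_right hw, zero_mul] at k1 k2
  intro a
  by_cases hax : a = x
  · rw [hax]; exact (mul_eq_zero.1 k1).resolve_right hcr
  · by_cases hay : a = y
    · rw [hay]; exact (mul_eq_zero.1 k2).resolve_right hcr
    · exact hz a hax hay

/-- A framework is stress-free if its stresses vanish at a vertex that may be deleted. -/
lemma StressFree.of_del {S : Finset V} {G : SimpleGraph V} {U U' : Finset V} {ρ : V → L}
    {p p' : V → K × K} {v : V} (h : StressFree (S.erase v) (del G v) U' ρ p) (hU : U' ⊆ U)
    (hp : ∀ x, x ≠ v → p x = p' x) (hn : v ∈ S → norm2 (p' v) ≠ 0)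
    (hv : ∀ ω l, IsStress S G p' ω l → IsBalanced U ρ l → ∀ a, ω a v = 0) :
    StressFree S G U ρ p' := by
  intro ω l hs hb
  have h1 := hv ω l hs hb
  exact h ω l (hs.transfer h1 (hs.load_eq_zero h1 hn) hp (fun x y hx hy ha => ⟨ha, hx, hy⟩)
    (fun x hx hxv => Finset.mem_erase.2 ⟨hxv, hx⟩)) (fun u hu => hb u (hU hu))

/-- Adding a vertex of degree at most one. -/
lemma StressFree.exists_extend_pendant {S : Finset V} {G : SimpleGraph V} {U : Finset V}
    {ρ : V → L} {p : V → K × K} {v x : V} (hG : ∀ a b, G.Adj a b → a ∈ S)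
    (hadm : IsAdmissible (S.erase v) ρ p)
    (hv : ∀ a, G.Adj v a → a = x) (h : StressFree (S.erase v) (del G v) (U.erase v) ρ p) :
    ∃ p' : V → K × K, IsAdmissible S ρ p' ∧ StressFree S G U ρ p' := by
  obtain ⟨R, hR, hRv⟩ := hadm.exists_radius v
  obtain ⟨z, hz⟩ := (eventually_circle_isAdmissible hadm hR hRv).exists
  refine ⟨_, hz, h.of_del (U.erase_subset v) (fun a ha => by simp [ha]) (hz.norm_ne v) ?_⟩
  intro ω l hs hb a
  by_cases hadj : G.Adj v a
  · obtain rfl := hv a hadj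
    have heq := hs.equil v
    rw [Finset.sum_eq_single a
      (fun b _ hb => by rw [hs.supp b v fun h => hb (hv b h.symm), zero_smul]) (by simp)] at heq
    have hc := hz.cross_ne v (hG _ _ hadj) a (hG _ _ hadj.symm) hadj.ne
    set q := Function.update p v (circlePoint R z)
    have e1 := congrArg Prod.fst heq
    have e2 := congrArg Prod.snd heq
    simp only [Prod.smul_fst, Prod.smul_snd, Prod.fst_sub, Prod.snd_sub, smul_eq_mul] at e1 e2
    -- The determinant with `q v` removes the radial load.
    have : ω a v * cross (q v) (q a) = 0 := by
      simp only [cross]; linear_combination (q v).1 * e2 - (q v).2 * e1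
    exact (mul_eq_zero.1 this).resolve_right hc
  · exact hs.supp a v fun h => hadj h.symm

/-- Adding a vertex of degree two whose label class becomes constrained. -/
lemma StressFree.exists_extend_two {S : Finset V} {G : SimpleGraph V} {U : Finset V}
    {ρ : V → L} {p : V → K × K} {v x y u : V} (hinj : Set.InjOn ρ U)
    (hadm : IsAdmissible (S.erase v) ρ p) (hx : x ∈ S.erase v) (hy : y ∈ S.erase v) (hxy : x ≠ y)
    (hv : ∀ a, G.Adj v a → a = x ∨ a = y) (hu : u ∈ U) (huv : ρ u = ρ v)
    (h : StressFree (S.erase v) (del G v) (U.erase u) ρ p) :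
    ∃ s : K × K, IsAdmissible S ρ (Function.update p v s) ∧
      StressFree S G U ρ (Function.update p v s) := by
  obtain ⟨m, τ, hm, hr⟩ := h.exists_motion_radial_ne hu hinj hadm.norm_ne
  rw [radial_congr huv] at hr
  obtain ⟨R, hR, hRv⟩ := hadm.exists_radius v
  have hcr := hadm.cross_ne x hx y hy hxy
  have hQ : ∀ᶠ z in Filter.cofinite, workTwo (p x) (p y) (m x) (m y) (radial U ρ τ v)
      (circlePoint R z) ≠ 0 := by
    simp only [workTwo_eq_quad]
    refine eventually_circle_quad_ne_zero ?_
    rintro ⟨ha, hb, hd, hce, hf⟩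
    have hb := (mul_eq_zero.1 hb).resolve_right hR
    have hf := (mul_eq_zero.1 hf).resolve_right (pow_ne_zero 2 hR)
    -- If the work vanishes on the circle, it is a multiple of `s.1 * s.2 - R`. It always vanishes
    -- at `p x`, so either that multiple is zero, which contradicts the nonzero constant term, or x
    -- lies on the circle.
    have h0 : workTwo (p x) (p y) (m x) (m y) (radial U ρ τ v) (p x) = 0 := by
      simp only [workTwo, cross, dot, Prod.fst_sub, Prod.snd_sub]; ring
    rw [workTwo_eq_quad] at h0
    simp only [quad, ha, hb, hd, hf, zero_mul, add_zero] at h0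
    have hnx : norm2 (p x) = R := by
      have h1 := sub_eq_zero.2 (h0.trans hce.symm)
      have h2 : ((p y).2 * (m x).2 - (p y).1 * (m x).1 + (p x).1 * (m y).1 - (p x).2 * (m y).2) *
          (norm2 (p x) - R) = 0 := by
        simp only [norm2]; linear_combination h1
      rcases mul_eq_zero.1 h2 with h3 | h3
      · rw [h3, zero_mul, add_zero] at hce
        exact absurd hce (mul_ne_zero hcr hr)
      · exact sub_eq_zero.1 h3
    -- Lying on the circle gives `x` the label of `v`, hence the same radial rate. Contracting the
    -- vanishing linear coefficients with `p x` then gives twice that rate equal to zero.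
    have hkx : dot (p x) (m x) = radial U ρ τ v := by
      rw [hm.vertex x hx, radial_congr ((hRv x hx).1 hnx)]
    have h1 : cross (p x) (p y) * (dot (p x) (m x) + radial U ρ τ v) = 0 := by
      simp only [cross]; linear_combination -(p x).1 * ha - (p x).2 * hb
    rw [hkx] at h1
    have h2 := (mul_eq_zero.1 h1).resolve_left hcr
    apply hr
    have : (2 : K) * radial U ρ τ v = 0 := by linear_combination h2
    simpa using this
  obtain ⟨z, hz, hQz⟩ := ((eventually_circle_isAdmissible hadm hR hRv).and hQ).exists
  refine ⟨_, hz, h.of_del (U.erase_subset u) (fun a ha => by simp [ha]) (hz.norm_ne v) ?_⟩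
  intro ω l hs hb
  have hxv := Finset.ne_of_mem_erase hx
  have hyv := Finset.ne_of_mem_erase hy
  have hne : ∀ a, a ≠ v → Function.update p v (circlePoint R z) a = p a := fun a ha => by simp [ha]
  refine hs.eq_zero_of_workTwo_ne (m := m) (τ := τ) hb ⟨fun a b hab => ?_, fun a ha => ?_⟩ hxy hv ?_ ?_
  · rw [hne a hab.2.1, hne b hab.2.2]; exact hm.edge a b hab
  · rw [hne a (Finset.ne_of_mem_erase ha)]; exact hm.vertex a ha
  · rwa [hne x hxv, hne y hyv]
  · rw [hne x hxv, hne y hyv]; simpa using hQz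

end Moves

/-! ### Relabelling a vertex of degree two, and adding one of degree three. -/

section Moves

variable {V L K : Type*} [Fintype V] [DecidableEq V] [DecidableEq L] [Field K]

lemma radial_congr_label {U : Finset V} {ρ ρ' : V → L} {τ : V → K} {x : V} (hx : ρ' x = ρ x)
    (hU : ∀ u ∈ U, ρ' u = ρ u) : radial U ρ' τ x = radial U ρ τ x := by
  simp only [radial, hx]
  exact Finset.sum_congr rfl fun u hu => by rw [hU u hu]

lemma StressFree.mono {S : Finset V} {G H : SimpleGraph V} {U : Finset V} {ρ : V → L}
    {p : V → K × K} (h : StressFree S H U ρ p) (hGH : G ≤ H) : StressFree S G U ρ p :=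
  fun ω l hs hb => h ω l
    ⟨hs.symm, fun u v huv => hs.supp u v fun h' => huv (hGH h'), hs.load_supp, hs.equil⟩ hb

/-- A free vertex of degree two in a stress-free framework has nonzero virtual work along some
motion of the remaining framework. -/
lemma StressFree.exists_motion_workTwo_ne {S : Finset V} {G : SimpleGraph V} {U : Finset V}
    {ρ ρ' : V → L} {p : V → K × K} {w x y : V} (hwS : w ∈ S)
    (hU : ∀ u ∈ U, ρ' u = ρ u ∧ ρ' w ≠ ρ u) (hρ : ∀ a, a ≠ w → ρ' a = ρ a)
    (hx : G.Adj w x) (hy : G.Adj w y) (hxy : x ≠ y) (hcr : cross (p x) (p y) ≠ 0)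
    (hw0 : norm2 (p w) ≠ 0) (h : StressFree S G U ρ' p) :
    ∃ m τ, IsMotion (S.erase w) (del G w) U ρ p m τ ∧
      workTwo (p x) (p y) (m x) (m y) 0 (p w) ≠ 0 := by
  by_contra! hcon
  set A := cross (p w) (p y) with hA
  set B := cross (p x) (p w) with hB
  set D := cross (p x) (p y) with hD
  let r : ((V → K × K) × (V → K)) →ₗ[K] K :=
    { toFun := fun q => A * dot (p w - p x) (q.1 x) + B * dot (p w - p y) (q.1 y)
      map_add' := by intro a b; simp [dot]; ring
      map_smul' := by intro a b; simp [dot]; ring }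
  obtain ⟨ω, l, h1, h2, h3, h4⟩ := exists_weights_of_forall_motion (S.erase w) (del G w) U ρ p r
    (fun m τ hm => by
      have := hcon m τ hm
      rw [workTwo, mul_zero, add_zero] at this
      exact this)
  have h4' : ∀ (m : V → K × K) (τ : V → K), A * dot (p w - p x) (m x) + B * dot (p w - p y) (m y) =
      ∑ x, ∑ u, ω u x * dot (p u - p x) (m x)
        - ∑ x, l x * dot (p x) (m x) + ∑ x, l x * radial U ρ τ x := fun m τ => h4 m τ
  have hlw : l w = 0 := h3 w (by simp)
  -- The two edges at `w` receive minus the Cramer weights. The resulting load at `w` does not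
  -- affect balance, because under `ρ'` the class of `w` misses `U`.
  have hs : IsStress S G p (fun a b => ω a b - A * unitWeight x w a b - B * unitWeight y w a b)
      (fun a => l a + if a = w then A + B - D else 0) := by
    refine ⟨fun a b => ?_, fun a b hab => ?_, fun a ha => ?_, (equil_iff p _ _).2 fun m => ?_⟩
    · rw [h1 a b, unitWeight_comm, unitWeight_comm y]
    · have k0 : ω a b = 0 := h2 a b fun h => hab h.1
      have k1 : (unitWeight x w a b : K) = 0 := by
        have h5 : ¬ (a = x ∧ b = w) := by rintro ⟨rfl, rfl⟩; exact hab hx.symm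
        have h6 : ¬ (a = w ∧ b = x) := by rintro ⟨rfl, rfl⟩; exact hab hx
        simp [unitWeight, h5, h6]
      have k2 : (unitWeight y w a b : K) = 0 := by
        have h5 : ¬ (a = y ∧ b = w) := by rintro ⟨rfl, rfl⟩; exact hab hy.symm
        have h6 : ¬ (a = w ∧ b = y) := by rintro ⟨rfl, rfl⟩; exact hab hy
        simp [unitWeight, h5, h6]
      rw [k0, k1, k2]; ring
    · have : a ≠ w := fun h => ha (h ▸ hwS)
      rw [h3 a (fun h => ha (Finset.mem_of_mem_erase h)), if_neg this, add_zero]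
    · have k := h4' m 0
      have k0 : ∑ x, l x * radial U ρ 0 x = (0 : K) := by simp [radial]
      simp only [sub_mul, add_mul, Finset.sum_sub_distrib, mul_assoc, ← Finset.mul_sum,
        sum_unitWeight, Finset.sum_add_distrib, ite_mul, zero_mul, Finset.sum_ite_eq',
        Finset.mem_univ, if_true]
      rw [k0] at k
      have e : A * dot (p x) (m w) + B * dot (p y) (m w) = D * dot (p w) (m w) := by
        simp only [hA, hB, hD, cross, dot]; ring
      simp only [dot, Prod.fst_sub, Prod.snd_sub] at k e ⊢
      linear_combination -k - e
  have hb : IsBalanced U ρ' (fun a => l a + if a = w then A + B - D else 0) := by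
    intro u hu
    have := h4' 0 (Pi.single u 1)
    simp only [dot, Pi.zero_apply, Prod.fst_zero, Prod.snd_zero, mul_zero, add_zero, sub_zero,
      Finset.sum_const_zero, zero_add, sum_mul_radial] at this
    rw [Finset.sum_eq_single u (by intro b _ hb; simp [hb]) (fun h => absurd hu h)] at this
    simp only [Pi.single_eq_same, one_mul] at this
    refine Eq.trans (Finset.sum_congr rfl fun a _ => ?_) this.symm
    by_cases haw : a = w
    · subst haw
      rw [(hU u hu).1, if_neg (hU u hu).2, hlw, ite_self]
    · simp only [(hU u hu).1, hρ a haw, if_neg haw, add_zero]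
  have hz := h _ _ hs hb
  have hxw := hx.ne
  have hyw := hy.ne
  have hA0 : A = 0 := by
    have := hz x w
    have k0 : ω x w = 0 := h2 x w fun h => h.2.2 rfl
    simpa [k0, unitWeight, hxy, hxw.symm, hyw.symm] using this
  have hB0 : B = 0 := by
    have := hz y w
    have k0 : ω y w = 0 := h2 y w fun h => h.2.2 rfl
    simpa [k0, unitWeight, hxy.symm, hxw.symm, hyw.symm] using this
  apply hw0
  -- By Cramer's rule `D • p w = A • p x + B • p y`, so both weights being zero would place `w` at
  -- the origin.
  have : D * (p w).1 = 0 := by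
    have e : A * (p x).1 + B * (p y).1 = D * (p w).1 := by
      simp only [hA, hB, hD, cross]; ring
    rw [← e, hA0, hB0]; ring
  simp [norm2, (mul_eq_zero.1 this).resolve_left hcr]

variable [CharZero K]

/-- A free vertex of degree two may join a constrained label class. -/
lemma StressFree.exists_relabel {S : Finset V} {G : SimpleGraph V} {U : Finset V}
    {ρ ρ' : V → L} {p : V → K × K} {u w x y : V} (hG : ∀ a b, G.Adj a b → a ∈ S)
    (hinj : Set.InjOn ρ U) (hwU : w ∉ U) (hρ : ∀ a, a ≠ w → ρ' a = ρ a)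
    (hw : ∀ a ∈ U, ρ' w ≠ ρ a) (hu : u ∈ U) (huw : ρ u = ρ w)
    (hx : G.Adj w x) (hy : G.Adj w y) (hxy : x ≠ y) (hN : ∀ a, G.Adj w a → a = x ∨ a = y)
    (hadm : IsAdmissible S ρ' p) (h : StressFree S G U ρ' p) :
    ∃ p' : V → K × K, IsAdmissible S ρ p' ∧ StressFree S G U ρ p' := by
  have hwS : w ∈ S := hG w x hx
  have hxS : x ∈ S.erase w := Finset.mem_erase.2 ⟨hx.ne', hG _ _ hx.symm⟩
  have hyS : y ∈ S.erase w := Finset.mem_erase.2 ⟨hy.ne', hG _ _ hy.symm⟩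
  have hUw : ∀ a ∈ U, a ≠ w := fun a ha haw => hwU (haw ▸ ha)
  have hU : ∀ a ∈ U, ρ' a = ρ a ∧ ρ' w ≠ ρ a := fun a ha => ⟨hρ a (hUw a ha), hw a ha⟩
  have hadm' : IsAdmissible (S.erase w) ρ p := by
    have hm : ∀ a ∈ S.erase w, a ∈ S := fun a ha => Finset.mem_of_mem_erase ha
    refine ⟨fun a ha b hb => hadm.cross_ne a (hm a ha) b (hm b hb),
      fun a ha b hb c hc => hadm.not_collinear a (hm a ha) b (hm b hb) c (hm c hc),
      fun a ha => hadm.norm_ne a (hm a ha), fun a ha b hb => ?_⟩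
    rw [hadm.norm_eq a (hm a ha) b (hm b hb), hρ a (Finset.ne_of_mem_erase ha),
      hρ b (Finset.ne_of_mem_erase hb)]
  -- If the framework without `w` stays stress-free when the class of `u` is fixed, releasing that
  -- class gives the motion needed to place `w`. Otherwise it has a nonzero stress violating balance
  -- only on the class of `u`, with total `M` there; this stress serves as a corrector.
  by_cases hfree : StressFree (S.erase w) (del G w) (U.erase u) ρ p
  · obtain ⟨s, h1, h2⟩ := hfree.exists_extend_two hinj hadm' hxS hyS hxy hN hu huw
    exact ⟨_, h1, h2⟩
  have hbal : ∀ l : V → K, l w = 0 → ∀ a ∈ U, ∑ b, (if ρ' b = ρ' a then l b else 0) =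
      ∑ b, if ρ b = ρ a then l b else 0 := by
    intro l hl a ha
    refine Finset.sum_congr rfl fun b _ => ?_
    by_cases hb : b = w
    · rw [hb, hl, ite_self, ite_self]
    · rw [hρ b hb, (hU a ha).1]
  simp only [StressFree, not_forall] at hfree
  obtain ⟨ω', l', hs', hb', hne⟩ := hfree
  have hω'w : ∀ a, ω' a w = 0 := fun a => hs'.supp a w fun h => h.2.2 rfl
  have hl'w : l' w = 0 := hs'.load_supp w (by simp)
  have hext : ∀ q : V → K × K, (∀ a, a ≠ w → q a = p a) → IsStress S G q ω' l' := fun q hq =>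
    hs'.transfer hω'w hl'w hq (fun a b _ _ hab => hab.1) fun a ha _ => Finset.mem_of_mem_erase ha
  set M := ∑ b, (if ρ b = ρ u then l' b else 0) with hM
  have hM0 : M ≠ 0 := by
    intro hM0
    obtain ⟨a, b, hab⟩ : ∃ a b, ¬ ω' a b = 0 := by simpa using hne
    refine hab (h ω' l' (hext p fun _ _ => rfl) (fun c hc => ?_) a b)
    rw [hbal l' hl'w c hc]
    by_cases hcu : c = u
    · rw [hcu]; exact hM0
    · exact hb' c (Finset.mem_erase.2 ⟨hcu, hc⟩)
  have hcr := hadm'.cross_ne x hxS y hyS hxy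
  obtain ⟨m, τ, hm, hQ⟩ := h.exists_motion_workTwo_ne hwS hU hρ hx hy hxy hcr (hadm.norm_ne w hwS)
  obtain ⟨R, hR, hRv⟩ := hadm'.exists_radius w
  have hQ' : ∀ᶠ z in Filter.cofinite, workTwo (p x) (p y) (m x) (m y) 0 (circlePoint R z) ≠ 0 := by
    simp only [workTwo_eq_quad] at hQ ⊢
    refine eventually_circle_quad_ne_zero ?_
    rintro ⟨ha, hb, hd, hce, hf⟩
    have hb := (mul_eq_zero.1 hb).resolve_right hR
    have hf := (mul_eq_zero.1 hf).resolve_right (pow_ne_zero 2 hR)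
    -- Without the radial term the quadratic has no constant coefficient, so vanishing on the circle
    -- forces it to vanish everywhere, including the old position of `w`.
    rw [mul_zero, zero_add] at hce
    have he := (mul_eq_zero.1 hce).resolve_right hR
    apply hQ
    simp only [quad, ha, hb, hd, he, hf]; ring
  obtain ⟨z, hz, hQz⟩ := ((eventually_circle_isAdmissible hadm' hR hRv).and hQ').exists
  set q := Function.update p w (circlePoint R z) with hq
  have hne : ∀ a, a ≠ w → q a = p a := fun a ha => by simp [hq, ha]
  have hqw : q w = circlePoint R z := by simp [hq]
  refine ⟨q, hz, ?_⟩
  have hm' : IsMotion (S.erase w) (del G w) U ρ' q m τ := by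
    refine ⟨fun a b hab => ?_, fun a ha => ?_⟩
    · rw [hne a hab.2.1, hne b hab.2.2]; exact hm.edge a b hab
    · have haw := Finset.ne_of_mem_erase ha
      rw [hne a haw, radial_congr_label (hρ a haw) fun b hb => (hU b hb).1]
      exact hm.vertex a ha
  have hrad : radial U ρ' τ w = 0 :=
    Finset.sum_eq_zero fun a ha => if_neg (by rw [(hU a ha).1]; exact (hU a ha).2)
  intro ω l hs hb
  have hzero : ∀ a, ω a w = 0 := by
    -- Removing `w` from the class of `u` leaves total load `-l w` there; this multiple of the
    -- corrector restores balance for `ρ'` without touching the edges at `w`.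
    have hs2 := hs.add_smul (hext q hne) (l w / M)
    have hb2 : IsBalanced U ρ' (fun a => l a + l w / M * l' a) := by
      intro a ha
      have e : ∀ b, (if ρ' b = ρ' a then l b + l w / M * l' b else 0) =
          (if ρ b = ρ a then l b else 0) + l w / M * (if ρ b = ρ a then l' b else 0) -
            if b = w then (if ρ w = ρ a then l w else 0) else 0 := by
        intro b
        by_cases hbw : b = w
        · subst hbw
          rw [(hU a ha).1, if_neg (hU a ha).2, hl'w]; simp
        · rw [hρ b hbw, (hU a ha).1, if_neg hbw]; split_ifs <;> ring
      simp only [e, Finset.sum_sub_distrib, Finset.sum_add_distrib, ← Finset.mul_sum,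
        Finset.sum_ite_eq', Finset.mem_univ, if_true]
      rw [hb a ha]
      by_cases hau : a = u
      · subst hau
        rw [← hM, if_pos huw.symm, div_mul_cancel₀ _ hM0]; ring
      · rw [hb' a (Finset.mem_erase.2 ⟨hau, ha⟩), if_neg]
        · ring
        · intro h'; exact hau (hinj ha hu (h'.symm.trans huw.symm))
    have := hs2.eq_zero_of_workTwo_ne hb2 hm' hxy hN
      (by rwa [hne x hx.ne', hne y hy.ne'])
      (by rw [hne x hx.ne', hne y hy.ne', hrad, hqw]; exact hQz)
    intro a
    simpa [hω'w] using this a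
  have hlw := hs.load_eq_zero hzero (hz.norm_ne w)
  exact h ω l (hs.transfer hzero hlw (fun a ha => (hne a ha).symm) (fun _ _ _ _ h => h)
    (fun _ h _ => h)) fun a ha => by rw [hbal l hlw a ha]; exact hb a ha

/-- The virtual work of an unloaded unit stress at a vertex `s` with three neighbours, up to a
factor. -/
def workThree (px py pz mx my mz : K × K) (s : K × K) : K :=
  cross (py - s) (pz - s) * dot (s - px) mx + cross (pz - s) (px - s) * dot (s - py) my +
    cross (px - s) (py - s) * dot (s - pz) mz

/-- Each factor `cross (q - s) (q' - s)` is affine in s, since `cross s s` is zero; its product with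
an affine function is quadratic. -/
lemma exists_workThree_eq_quad (px py pz mx my mz : K × K) :
    ∃ c a b d e f, ∀ s, workThree px py pz mx my mz s = quad c a b d e f s := by
  have h1 : ∀ q q' k t : K × K, ∃ c a b d e f, ∀ s,
      cross (q - s) (q' - s) * dot (s - k) t = quad c a b d e f s := by
    intro q q' k t
    refine ⟨-(cross q q' * dot k t), cross q q' * t.1 - (q.2 - q'.2) * dot k t,
      cross q q' * t.2 - (q'.1 - q.1) * dot k t, (q.2 - q'.2) * t.1,
      (q.2 - q'.2) * t.2 + (q'.1 - q.1) * t.1, (q'.1 - q.1) * t.2, fun s => ?_⟩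
    simp only [quad, cross, dot, Prod.fst_sub, Prod.snd_sub]; ring
  obtain ⟨c1, a1, b1, d1, e1, f1, k1⟩ := h1 py pz px mx
  obtain ⟨c2, a2, b2, d2, e2, f2, k2⟩ := h1 pz px py my
  obtain ⟨c3, a3, b3, d3, e3, f3, k3⟩ := h1 px py pz mz
  refine ⟨c1 + c2 + c3, a1 + a2 + a3, b1 + b2 + b3, d1 + d2 + d3, e1 + e2 + e3, f1 + f2 + f3,
    fun s => ?_⟩
  rw [workThree, k1, k2, k3]; simp only [quad]; ring

/-- Replacing an edge `xy` by a vertex of degree three that is alone in its label class. -/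
lemma StressFree.exists_extend_three {S : Finset V} {G : SimpleGraph V} {U : Finset V}
    {ρ : V → L} {p : V → K × K} {v x y z : V}
    (hadm : IsAdmissible (S.erase v) ρ p) (hx : x ∈ S.erase v) (hy : y ∈ S.erase v)
    (hz : z ∈ S.erase v) (hxy : x ≠ y) (hxz : x ≠ z) (hyz : y ≠ z)
    (hv : ∀ a, G.Adj v a → a = x ∨ a = y ∨ a = z) (hvU : v ∈ U)
    (hlab : ∀ a ∈ S.erase v, ρ a ≠ ρ v) (hadj : ¬ G.Adj x y)
    (h : StressFree (S.erase v) (del G v ⊔ SimpleGraph.edge x y) (U.erase v) ρ p) :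
    ∃ p' : V → K × K, IsAdmissible S ρ p' ∧ StressFree S G U ρ p' := by
  obtain ⟨m, τ, hm, hr⟩ := h.exists_motion_edge_ne hxy fun h' : (del G v).Adj x y => hadj h'.1
  have hD := hadm.not_collinear x hx y hy z hz hxy hxz hyz
  have hQ : ∀ᶠ t in Filter.cofinite, workThree (p x) (p y) (p z) (m x) (m y) (m z)
      (cubicPoint t) ≠ 0 := by
    obtain ⟨c, a, b, d, e, f, hq⟩ := exists_workThree_eq_quad (p x) (p y) (p z) (m x) (m y) (m z)
    simp only [hq]
    refine eventually_cubic_quad_ne_zero ?_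
    rintro ⟨rfl, rfl, rfl, rfl, rfl, rfl⟩
    -- At the midpoint of `xy` the work is -1/4 times the product of the triangle determinant and
    -- the length change of `xy`, hence nonzero.
    have h0 := hq (((p x).1 + (p y).1) / 2, ((p x).2 + (p y).2) / 2)
    have h1 : quad 0 0 0 0 0 0 (((p x).1 + (p y).1) / 2, ((p x).2 + (p y).2) / 2) = (0 : K) := by
      simp [quad]
    rw [h1] at h0
    have h2 : cross (p y - p x) (p z - p x) * dot (p x - p y) (m x - m y) = 0 := by
      simp only [workThree, cross, dot, Prod.fst_sub, Prod.snd_sub] at h0 ⊢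
      linear_combination -4 * h0
    exact (mul_ne_zero hD hr) h2
  -- No other joint of `S` shares the label of `v`, so its radius is free and the cubic may replace
  -- a circle.
  obtain ⟨t, ht, hQt⟩ := ((eventually_cubic_isAdmissible hadm hlab).and hQ).exists
  refine ⟨_, ht, (h.mono le_sup_left).of_del (U.erase_subset v) (fun a ha => by simp [ha])
    (ht.norm_ne v) ?_⟩
  intro ω l hs hb
  set q := Function.update p v (cubicPoint t) with hq
  have hne : ∀ a, a ≠ v → q a = p a := fun a ha => by simp [hq, ha]
  have hqv : q v = cubicPoint t := by simp [hq]
  -- Balance on a class with a single joint forces its load to vanish.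
  have hlv : l v = 0 := by
    have := hb v hvU
    rwa [Finset.sum_eq_single v, if_pos rfl] at this
    · intro b _ hbv
      by_cases hbS : b ∈ S
      · exact if_neg (hlab b (Finset.mem_erase.2 ⟨hbv, hbS⟩))
      · rw [hs.load_supp b hbS, ite_self]
    · simp
  have hm' : IsMotion (S.erase v) (del G v) (U.erase v) ρ q m τ := by
    refine ⟨fun a b hab => ?_, fun a ha => ?_⟩
    · rw [hne a hab.2.1, hne b hab.2.2]; exact hm.edge a b hab
    · rw [hne a (Finset.ne_of_mem_erase ha)]; exact hm.vertex a ha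
  have hvw := hs.virtual_work (fun u hu => hb u (Finset.mem_of_mem_erase hu)) hm'
  have heq := hs.equil v
  have hzero : ∀ a, a ∉ ({x, y, z} : Finset V) → ω a v = 0 := by
    intro a ha
    refine hs.supp a v fun h => ha ?_
    simpa using hv a h.symm
  have hsum : ∀ {W : Type _} [AddCommMonoid W] (f : V → W), (∀ a, ω a v = 0 → f a = 0) →
      ∑ a, f a = f x + (f y + f z) := by
    intro W _ f hf
    rw [← Finset.sum_subset (Finset.subset_univ {x, y, z}) fun a _ ha => hf a (hzero a ha),
      Finset.sum_insert (by simp [hxy, hxz]), Finset.sum_insert (by simp [hyz]),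
      Finset.sum_singleton]
  rw [hsum _ (fun a ha => by simp [ha]), hlv, zero_mul, add_zero] at hvw
  rw [hsum _ (fun a ha => by simp [ha]), hlv, zero_smul] at heq
  rw [hne x (Finset.ne_of_mem_erase hx), hne y (Finset.ne_of_mem_erase hy),
    hne z (Finset.ne_of_mem_erase hz), hqv] at hvw heq
  set s := cubicPoint t
  have e1 := congrArg Prod.fst heq
  have e2 := congrArg Prod.snd heq
  simp only [Prod.fst_add, Prod.snd_add, Prod.smul_fst, Prod.smul_snd, Prod.fst_sub, Prod.snd_sub,
    smul_eq_mul, Prod.fst_zero, Prod.snd_zero] at e1 e2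
  -- Without a load, the three weights are proportional to the determinants in `workThree`; the
  -- virtual work then kills each of them.
  have kxy : ω x v * cross (p z - s) (p x - s) = ω y v * cross (p y - s) (p z - s) := by
    simp only [cross, Prod.fst_sub, Prod.snd_sub]
    linear_combination ((p z).1 - s.1) * e2 - ((p z).2 - s.2) * e1
  have kxz : ω x v * cross (p x - s) (p y - s) = ω z v * cross (p y - s) (p z - s) := by
    simp only [cross, Prod.fst_sub, Prod.snd_sub]
    linear_combination ((p y).2 - s.2) * e1 - ((p y).1 - s.1) * e2
  have kyz : ω y v * cross (p x - s) (p y - s) = ω z v * cross (p z - s) (p x - s) := by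
    simp only [cross, Prod.fst_sub, Prod.snd_sub]
    linear_combination ((p x).1 - s.1) * e2 - ((p x).2 - s.2) * e1
  have hx0 : ω x v = 0 := by
    refine (mul_eq_zero.1 ?_).resolve_right hQt
    simp only [workThree]
    linear_combination cross (p y - s) (p z - s) * hvw + dot (s - p y) (m y) * kxy +
      dot (s - p z) (m z) * kxz
  have hy0 : ω y v = 0 := by
    refine (mul_eq_zero.1 ?_).resolve_right hQt
    simp only [workThree]
    linear_combination cross (p z - s) (p x - s) * hvw - dot (s - p x) (m x) * kxy +
      dot (s - p z) (m z) * kyz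
  have hz0 : ω z v = 0 := by
    refine (mul_eq_zero.1 ?_).resolve_right hQt
    simp only [workThree]
    linear_combination cross (p x - s) (p y - s) * hvw - dot (s - p x) (m x) * kxz -
      dot (s - p y) (m y) * kyz
  intro a
  by_cases ha : a ∈ ({x, y, z} : Finset V)
  · simp only [Finset.mem_insert, Finset.mem_singleton] at ha
    rcases ha with rfl | rfl | rfl <;> assumption
  · exact hzero a ha

end Moves

/-! ### Sparsity counts, tight sets and the inductive construction. -/

section Counting

variable {V : Type*} [Fintype V] [DecidableEq V]

open Classical in
/-- The edges of `G` with both ends in `X`. -/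
noncomputable def edgesIn (G : SimpleGraph V) (X : Finset V) : Finset (Sym2 V) :=
  {e | e ∈ G.edgeSet ∧ ∀ a ∈ e, a ∈ X}

lemma mem_edgesIn {G : SimpleGraph V} {X : Finset V} {e : Sym2 V} :
    e ∈ edgesIn G X ↔ e ∈ G.edgeSet ∧ ∀ a ∈ e, a ∈ X := by
  simp [edgesIn]

open Classical in
/-- The neighbours of `v`. -/
noncomputable def nbrs (G : SimpleGraph V) (v : V) : Finset V := {a | G.Adj v a}

lemma mem_nbrs {G : SimpleGraph V} {v a : V} : a ∈ nbrs G v ↔ G.Adj v a := by simp [nbrs]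

lemma edgesIn_inter (G : SimpleGraph V) (X Y : Finset V) :
    edgesIn G (X ∩ Y) = edgesIn G X ∩ edgesIn G Y := by
  ext e
  simp only [mem_edgesIn, Finset.mem_inter]
  exact ⟨fun h => ⟨⟨h.1, fun a ha => (h.2 a ha).1⟩, ⟨h.1, fun a ha => (h.2 a ha).2⟩⟩,
    fun h => ⟨h.1.1, fun a ha => ⟨h.1.2 a ha, h.2.2 a ha⟩⟩⟩

lemma edgesIn_mono {G : SimpleGraph V} {X Y : Finset V} (h : X ⊆ Y) :
    edgesIn G X ⊆ edgesIn G Y := fun e he => by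
  rw [mem_edgesIn] at he ⊢
  exact ⟨he.1, fun a ha => h (he.2 a ha)⟩

lemma card_edgesIn_supermodular (G : SimpleGraph V) (X Y : Finset V) :
    (edgesIn G X).card + (edgesIn G Y).card ≤
      (edgesIn G (X ∪ Y)).card + (edgesIn G (X ∩ Y)).card := by
  rw [edgesIn_inter, ← Finset.card_union_add_card_inter]
  exact Nat.add_le_add_right (Finset.card_le_card (Finset.union_subset
    (edgesIn_mono Finset.subset_union_left) (edgesIn_mono Finset.subset_union_right))) _

lemma edgesIn_eq_empty {G : SimpleGraph V} {X : Finset V} (h : X.card ≤ 1) :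
    edgesIn G X = ∅ := by
  rw [Finset.eq_empty_iff_forall_notMem]
  intro e
  induction e with
  | _ a b =>
    intro he
    rw [mem_edgesIn, SimpleGraph.mem_edgeSet] at he
    exact he.1.ne (Finset.card_le_one.1 h a (he.2 a (by simp)) b (he.2 b (by simp)))

lemma sum_card_nbrs {G : SimpleGraph V} {S : Finset V} (hG : ∀ a b, G.Adj a b → a ∈ S) :
    ∑ v ∈ S, (nbrs G v).card = 2 * (edgesIn G S).card := by
  classical
  have h1 : edgesIn G S = G.edgeFinset := by
    ext e
    rw [mem_edgesIn, SimpleGraph.mem_edgeFinset]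
    refine ⟨fun h => h.1, fun h => ⟨h, ?_⟩⟩
    induction e with
    | _ a b =>
      intro c hc
      rcases Sym2.mem_iff.1 hc with rfl | rfl
      · exact hG _ _ h
      · exact hG _ _ (SimpleGraph.Adj.symm h)
  rw [h1, ← SimpleGraph.sum_degrees_eq_twice_card_edges]
  have h2 : ∀ v, (nbrs G v).card = G.degree v := fun v => by
    rw [SimpleGraph.degree]; congr 1; ext a; simp [mem_nbrs]
  simp only [h2]
  refine Finset.sum_subset (Finset.subset_univ S) fun v _ hv => ?_
  rw [← h2, Finset.card_eq_zero, Finset.eq_empty_iff_forall_notMem]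
  intro a ha
  exact hv (hG _ _ (mem_nbrs.1 ha))

/-- The sparsity counts of a graph on `S` all of whose colours occur exactly once, on `U`. -/
structure IsSparse (S : Finset V) (G : SimpleGraph V) (U : Finset V) : Prop where
  forest : ∀ X ⊆ S, X.Nonempty → (edgesIn G X).card + 1 ≤ X.card + (U ∩ X).card
  laman : ∀ X ⊆ S, 2 ≤ X.card → (edgesIn G X).card + 3 ≤ 2 * X.card

lemma IsSparse.mono {S S' : Finset V} {G : SimpleGraph V} {U : Finset V} (h : IsSparse S G U)
    (hS : S' ⊆ S) : IsSparse S' G U :=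
  ⟨fun X hX => h.forest X (hX.trans hS), fun X hX => h.laman X (hX.trans hS)⟩

lemma edgesIn_del_subset (G : SimpleGraph V) (v : V) (X : Finset V) :
    edgesIn (del G v) X ⊆ edgesIn G X := by
  intro e
  induction e with
  | _ a b =>
    intro he
    rw [mem_edgesIn, SimpleGraph.mem_edgeSet] at he ⊢
    exact ⟨he.1.1, he.2⟩

lemma erase_inter_eq {U X S : Finset V} {v : V} (hX : X ⊆ S.erase v) :
    U.erase v ∩ X = U ∩ X := by
  ext a
  simp only [Finset.mem_inter, Finset.mem_erase]
  exact ⟨fun h => ⟨h.1.2, h.2⟩, fun h => ⟨⟨Finset.ne_of_mem_erase (hX h.2), h.1⟩, h.2⟩⟩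

lemma IsSparse.del {S : Finset V} {G : SimpleGraph V} {U : Finset V} (h : IsSparse S G U) (v : V) :
    IsSparse (S.erase v) (del G v) (U.erase v) where
  forest X hX hne := by
    rw [erase_inter_eq hX]
    have := h.forest X (hX.trans (Finset.erase_subset _ _)) hne
    have := Finset.card_le_card (edgesIn_del_subset G v X)
    omega
  laman X hX hne := by
    have := h.laman X (hX.trans (Finset.erase_subset _ _)) hne
    have := Finset.card_le_card (edgesIn_del_subset G v X)
    omega

/-- `X` attains the planar rigidity count. -/
def IsLamanTight (G : SimpleGraph V) (X : Finset V) : Prop :=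
  2 ≤ X.card ∧ 2 * X.card ≤ (edgesIn G X).card + 3

/-- `X` attains the colour count. -/
def IsColourTight (G : SimpleGraph V) (U X : Finset V) : Prop :=
  X.card + (U ∩ X).card ≤ (edgesIn G X).card + 1

lemma card_inter_union (U X Y : Finset V) :
    (U ∩ (X ∪ Y)).card + (U ∩ (X ∩ Y)).card = (U ∩ X).card + (U ∩ Y).card := by
  rw [Finset.inter_union_distrib_left, ← Finset.card_union_add_card_inter (U ∩ X) (U ∩ Y)]
  congr 2
  ext a; simp only [Finset.mem_inter]; tauto

lemma card_inter_le_add_sdiff (U Z Y : Finset V) :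
    (U ∩ Z).card ≤ (U ∩ Y).card + (Z \ Y).card := by
  refine le_trans (Finset.card_le_card ?_) (Finset.card_union_le _ _)
  intro a
  simp only [Finset.mem_inter, Finset.mem_union, Finset.mem_sdiff]
  tauto

section Tight

variable {S : Finset V} {G : SimpleGraph V} {U X Y Z : Finset V}

/-- One common vertex is enough, because the colour count applies to every nonempty intersection. -/
lemma IsColourTight.union (h : IsSparse S G U) (hX : IsColourTight G U X)
    (hY : IsColourTight G U Y) (hXS : X ⊆ S) (hXY : (X ∩ Y).Nonempty) :
    IsColourTight G U (X ∪ Y) := by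
  have h1 := h.forest (X ∩ Y) (Finset.inter_subset_left.trans hXS) hXY
  have h2 := card_edgesIn_supermodular G X Y
  have h3 := card_inter_union U X Y
  have h4 := Finset.card_union_add_card_inter X Y
  simp only [IsColourTight] at *
  omega

/-- Two common vertices are needed, because the planar count starts at pairs. -/
lemma IsLamanTight.union (h : IsSparse S G U) (hX : IsLamanTight G X)
    (hY : IsLamanTight G Y) (hXS : X ⊆ S) (hXY : 2 ≤ (X ∩ Y).card) :
    IsLamanTight G (X ∪ Y) := by
  have h1 := h.laman (X ∩ Y) (Finset.inter_subset_left.trans hXS) hXY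
  have h2 := card_edgesIn_supermodular G X Y
  have h4 := Finset.card_union_add_card_inter X Y
  have h5 := Finset.card_le_card (Finset.inter_subset_left : X ∩ Y ⊆ X)
  have h6 := Finset.card_le_card (Finset.subset_union_left : X ⊆ X ∪ Y)
  simp only [IsLamanTight] at *
  omega

/-- Beyond the intersection, Laman tightness supplies two edges per vertex of X: one pays for the
vertex and one for its possible membership in U. -/
lemma IsLamanTight.union_colourTight (h : IsSparse S G U) (hX : IsLamanTight G X)
    (hY : IsColourTight G U Y) (hXS : X ⊆ S) (hXY : 2 ≤ (X ∩ Y).card) :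
    IsColourTight G U (X ∪ Y) := by
  have h1 := h.laman (X ∩ Y) (Finset.inter_subset_left.trans hXS) hXY
  have h2 := card_edgesIn_supermodular G X Y
  have h3 := card_inter_le_add_sdiff U (X ∪ Y) Y
  have h4 := Finset.card_union_add_card_inter X Y
  have h5 := Finset.card_sdiff_add_card_inter X Y
  rw [Finset.union_sdiff_right] at h3
  simp only [IsLamanTight, IsColourTight] at *
  omega

/-- Pairwise almost disjoint vertex sets span disjoint edge sets. -/
lemma card_edgesIn_add_three_le (hXY : (X ∩ Y).card ≤ 1) (hXZ : (X ∩ Z).card ≤ 1)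
    (hYZ : (Y ∩ Z).card ≤ 1) :
    (edgesIn G X).card + (edgesIn G Y).card + (edgesIn G Z).card ≤
      (edgesIn G (X ∪ Y ∪ Z)).card := by
  have d : ∀ {A B : Finset V}, (A ∩ B).card ≤ 1 → Disjoint (edgesIn G A) (edgesIn G B) :=
    fun hAB => by rw [Finset.disjoint_iff_inter_eq_empty, ← edgesIn_inter, edgesIn_eq_empty hAB]
  rw [← Finset.card_union_of_disjoint (d hXY), ← Finset.card_union_of_disjoint
    (Finset.disjoint_union_left.2 ⟨d hXZ, d hYZ⟩)]
  refine Finset.card_le_card (Finset.union_subset (Finset.union_subset ?_ ?_) ?_)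
  · exact edgesIn_mono (Finset.subset_union_left.trans Finset.subset_union_left)
  · exact edgesIn_mono (Finset.subset_union_right.trans Finset.subset_union_left)
  · exact edgesIn_mono Finset.subset_union_right

lemma card_union_three_add_le {x y z : V} (hxy : x ≠ y) (hxz : x ≠ z) (hyz : y ≠ z) (hx : x ∈ X)
    (hy : y ∈ X) (hy' : y ∈ Y) (hz : z ∈ Y) (hx' : x ∈ Z) (hz' : z ∈ Z) :
    (X ∪ Y ∪ Z).card + 3 ≤ X.card + Y.card + Z.card := by
  have h1 := Finset.card_union_add_card_inter X Y
  have h2 := Finset.card_union_add_card_inter (X ∪ Y) Z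
  have h3 : 1 ≤ (X ∩ Y).card := Finset.card_pos.2 ⟨y, Finset.mem_inter.2 ⟨hy, hy'⟩⟩
  have h4 : 2 ≤ ((X ∪ Y) ∩ Z).card := by
    rw [← Finset.card_pair hxz]
    refine Finset.card_le_card fun a ha => ?_
    simp only [Finset.mem_insert, Finset.mem_singleton] at ha
    rcases ha with rfl | rfl <;> simp [*]
  omega

/-- Two Laman tight sets and a tight set on the sides of a triangle have a tight union. -/
lemma IsLamanTight.union_three (h : IsSparse S G U) {x y z : V} (hxy : x ≠ y) (hxz : x ≠ z)
    (hyz : y ≠ z) (hx : x ∈ X) (hy : y ∈ X) (hy' : y ∈ Y) (hz : z ∈ Y) (hx' : x ∈ Z) (hz' : z ∈ Z)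
    (hXS : X ⊆ S) (hYS : Y ⊆ S) (hZS : Z ⊆ S) (hX : IsLamanTight G X) (hZ : IsLamanTight G Z)
    (hY : IsLamanTight G Y ∨ IsColourTight G U Y) :
    ∃ W ⊆ S, x ∈ W ∧ y ∈ W ∧ z ∈ W ∧ (IsLamanTight G W ∨ IsColourTight G U W) := by
  by_cases hXZ : 2 ≤ (X ∩ Z).card
  · exact ⟨X ∪ Z, Finset.union_subset hXS hZS, by simp [*], by simp [*], by simp [*],
      Or.inl (hX.union h hZ hXS hXZ)⟩
  by_cases hXY : 2 ≤ (X ∩ Y).card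
  · exact ⟨X ∪ Y, Finset.union_subset hXS hYS, by simp [*], by simp [*], by simp [*],
      hY.imp (fun hY => hX.union h hY hXS hXY) fun hY => hX.union_colourTight h hY hXS hXY⟩
  by_cases hZY : 2 ≤ (Z ∩ Y).card
  · exact ⟨Z ∪ Y, Finset.union_subset hZS hYS, by simp [*], by simp [*], by simp [*],
      hY.imp (fun hY => hZ.union h hY hZS hZY) fun hY => hZ.union_colourTight h hY hZS hZY⟩
  rw [Finset.inter_comm] at hZY
  -- No edge is shared, while each corner of the triangle is counted in two sets. In the Laman case
  -- the saving 2·3 reduces the three constants 3 to a single one; in the colour case two bounds of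
  -- twice the cardinality absorb the deficit.
  have h1 := card_edgesIn_add_three_le (G := G) (by omega : (X ∩ Y).card ≤ 1)
    (by omega : (X ∩ Z).card ≤ 1) (by omega : (Y ∩ Z).card ≤ 1)
  have h2 := card_union_three_add_le hxy hxz hyz hx hy hy' hz hx' hz'
  refine ⟨X ∪ Y ∪ Z, Finset.union_subset (Finset.union_subset hXS hYS) hZS, by simp [*],
    by simp [*], by simp [*], hY.imp (fun hY => ?_) fun hY => ?_⟩
  · have h5 : X.card ≤ (X ∪ Y ∪ Z).card :=
      Finset.card_le_card (Finset.subset_union_left.trans Finset.subset_union_left)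
    simp only [IsLamanTight] at *
    omega
  · have h3 := card_inter_le_add_sdiff U (X ∪ Y ∪ Z) Y
    have h4 : ((X ∪ Y ∪ Z) \ Y).card + Y.card = (X ∪ Y ∪ Z).card :=
      Finset.card_sdiff_add_card_eq_card
        (Finset.subset_union_right.trans Finset.subset_union_left)
    simp only [IsLamanTight, IsColourTight] at *
    omega

/-- Two colour tight sets meet in a corner and merge directly. Otherwise at most one of the three is
colour tight and the triangle lemma applies with its corners permuted. -/
lemma exists_tight_union (h : IsSparse S G U) {x y z : V} (hxy : x ≠ y) (hxz : x ≠ z)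
    (hyz : y ≠ z) (hx : x ∈ X) (hy : y ∈ X) (hy' : y ∈ Y) (hz : z ∈ Y) (hx' : x ∈ Z) (hz' : z ∈ Z)
    (hXS : X ⊆ S) (hYS : Y ⊆ S) (hZS : Z ⊆ S) (hX : IsLamanTight G X ∨ IsColourTight G U X)
    (hY : IsLamanTight G Y ∨ IsColourTight G U Y) (hZ : IsLamanTight G Z ∨ IsColourTight G U Z) :
    ∃ W ⊆ S, x ∈ W ∧ y ∈ W ∧ z ∈ W ∧ (IsLamanTight G W ∨ IsColourTight G U W) := by
  rcases hX with hX | hX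
  · rcases hZ with hZ | hZ
    · exact hX.union_three h hxy hxz hyz hx hy hy' hz hx' hz' hXS hYS hZS hZ hY
    · rcases hY with hY | hY
      · obtain ⟨W, h1, h2, h3, h4, h5⟩ := hX.union_three h hxy.symm hyz hxz hy hx hx' hz' hy' hz
          hXS hZS hYS hY (Or.inr hZ)
        exact ⟨W, h1, h3, h2, h4, h5⟩
      · exact ⟨Y ∪ Z, Finset.union_subset hYS hZS, by simp [*], by simp [*], by simp [*],
          Or.inr (hY.union h hZ hYS ⟨z, by simp [*]⟩)⟩
  · rcases hY with hY | hY
    · rcases hZ with hZ | hZ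
      · obtain ⟨W, h1, h2, h3, h4, h5⟩ := hY.union_three h hyz.symm hxz.symm hxy.symm hz hy' hy hx
          hz' hx' hYS hXS hZS hZ (Or.inr hX)
        exact ⟨W, h1, h4, h3, h2, h5⟩
      · exact ⟨X ∪ Z, Finset.union_subset hXS hZS, by simp [*], by simp [*], by simp [*],
          Or.inr (hX.union h hZ hXS ⟨x, by simp [*]⟩)⟩
    · exact ⟨X ∪ Y, Finset.union_subset hXS hYS, by simp [*], by simp [*], by simp [*],
          Or.inr (hX.union h hY hXS ⟨y, by simp [*]⟩)⟩

/-- If the edge `ab` cannot be added, then `a` and `b` lie in a common tight set. -/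
lemma IsSparse.exists_tight_of_not_sup_edge (h : IsSparse S G U) {v a b : V} (ha : a ∈ S.erase v)
    (hb : b ∈ S.erase v) (hab : a ≠ b) (hcon : ¬ (¬ G.Adj a b ∧
      IsSparse (S.erase v) (VariableSpheres.del G v ⊔ SimpleGraph.edge a b) (U.erase v))) :
    ∃ X ⊆ S.erase v, a ∈ X ∧ b ∈ X ∧ (IsLamanTight G X ∨ IsColourTight G U X) := by
  by_cases hadj : G.Adj a b
  · refine ⟨{a, b}, by simp [Finset.insert_subset_iff, ha, hb, -Finset.mem_erase], by simp,
      by simp, Or.inl ?_⟩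
    have : 1 ≤ (edgesIn G {a, b}).card := Finset.card_pos.2 ⟨s(a, b), by
      rw [mem_edgesIn]; exact ⟨hadj, by simp⟩⟩
    rw [IsLamanTight, Finset.card_pair hab]
    omega
  · have hns := fun hh => hcon ⟨hadj, hh⟩
    by_contra! hno
    have hsub : ∀ X, edgesIn (VariableSpheres.del G v ⊔ SimpleGraph.edge a b) X ⊆
        insert s(a, b) (edgesIn G X) := by
      intro X e
      induction e with
      | _ c d =>
        intro he
        rw [mem_edgesIn, SimpleGraph.mem_edgeSet, SimpleGraph.sup_adj, SimpleGraph.edge_adj] at he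
        rw [Finset.mem_insert, mem_edgesIn, SimpleGraph.mem_edgeSet]
        rcases he with ⟨h1 | h1, h2⟩
        · exact Or.inr ⟨h1.1, h2⟩
        · left
          rcases h1.1 with ⟨rfl, rfl⟩ | ⟨rfl, rfl⟩
          · rfl
          · exact Sym2.eq_swap
    have hcard : ∀ X ⊆ S.erase v,
        (edgesIn (VariableSpheres.del G v ⊔ SimpleGraph.edge a b) X).card ≤ (edgesIn G X).card ∨
        (edgesIn (VariableSpheres.del G v ⊔ SimpleGraph.edge a b) X).card ≤ (edgesIn G X).card + 1 ∧
          ¬ IsLamanTight G X ∧ ¬ IsColourTight G U X := by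
      intro X hX
      by_cases hin : a ∈ X ∧ b ∈ X
      · right
        exact ⟨(Finset.card_le_card (hsub X)).trans (Finset.card_insert_le _ _),
          hno X hX hin.1 hin.2⟩
      · left
        refine Finset.card_le_card fun e he => ?_
        rcases Finset.mem_insert.1 (hsub X he) with rfl | h1
        · exact absurd ⟨(mem_edgesIn.1 he).2 a (by simp), (mem_edgesIn.1 he).2 b (by simp)⟩ hin
        · exact h1
    refine hns ⟨fun X hX hne => ?_, fun X hX hne => ?_⟩
    · rw [erase_inter_eq hX]
      have h1 := h.forest X (hX.trans (Finset.erase_subset _ _)) hne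
      rcases hcard X hX with h2 | ⟨h2, -, h3⟩
      · omega
      · simp only [IsColourTight] at h3; omega
    · have h1 := h.laman X (hX.trans (Finset.erase_subset _ _)) hne
      rcases hcard X hX with h2 | ⟨h2, h3, -⟩
      · omega
      · simp only [IsLamanTight] at h3; omega

/-- A vertex of degree three in `U` may be replaced by an edge between two of its neighbours. -/
lemma IsSparse.exists_sup_edge (h : IsSparse S G U) (hG : ∀ a b, G.Adj a b → a ∈ S) {v x y z : V}
    (hvU : v ∈ U) (hxy : x ≠ y) (hxz : x ≠ z) (hyz : y ≠ z) (hx : G.Adj v x) (hy : G.Adj v y)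
    (hz : G.Adj v z) :
    (¬ G.Adj x y ∧
      IsSparse (S.erase v) (VariableSpheres.del G v ⊔ SimpleGraph.edge x y) (U.erase v)) ∨
    (¬ G.Adj y z ∧
      IsSparse (S.erase v) (VariableSpheres.del G v ⊔ SimpleGraph.edge y z) (U.erase v)) ∨
    (¬ G.Adj x z ∧
      IsSparse (S.erase v) (VariableSpheres.del G v ⊔ SimpleGraph.edge x z) (U.erase v)) := by
  by_contra hcon
  simp only [not_or] at hcon
  obtain ⟨c1, c2, c3⟩ := hcon
  have mem : ∀ {a}, G.Adj v a → a ∈ S.erase v := fun {a} ha =>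
    Finset.mem_erase.2 ⟨ha.ne', hG a v ha.symm⟩
  obtain ⟨X, hXS, hx1, hy1, hX⟩ := h.exists_tight_of_not_sup_edge (mem hx) (mem hy) hxy c1
  obtain ⟨Y, hYS, hy2, hz2, hY⟩ := h.exists_tight_of_not_sup_edge (mem hy) (mem hz) hyz c2
  obtain ⟨Z, hZS, hx3, hz3, hZ⟩ := h.exists_tight_of_not_sup_edge (mem hx) (mem hz) hxz c3
  obtain ⟨W, hWS, hxW, hyW, hzW, hW⟩ := exists_tight_union (h.mono (S.erase_subset v)) hxy hxz hyz
    hx1 hy1 hy2 hz2 hx3 hz3 hXS hYS hZS hX hY hZ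
  -- Adding `v` to `W` brings three new edges but raises each bound by only two, since `v ∈ U`. This
  -- is incompatible with either kind of tightness.
  have hvW : v ∉ W := fun hv => Finset.ne_of_mem_erase (hWS hv) rfl
  have hvS : v ∈ S := hG v x hx
  have hWS' : insert v W ⊆ S := Finset.insert_subset hvS (hWS.trans (S.erase_subset v))
  have h1 := h.forest _ hWS' (Finset.insert_nonempty v W)
  have h2 := h.laman _ hWS' (by
    rw [Finset.card_insert_of_notMem hvW]
    have := Finset.card_pos.2 ⟨x, hxW⟩
    omega)
  have h3 : (U ∩ insert v W).card = (U ∩ W).card + 1 := by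
    rw [Finset.inter_insert_of_mem hvU, Finset.card_insert_of_notMem]
    exact fun h => hvW (Finset.mem_inter.1 h).2
  have h4 : (edgesIn G W).card + 3 ≤ (edgesIn G (insert v W)).card := by
    have hd : Disjoint (edgesIn G W) {s(v, x), s(v, y), s(v, z)} := by
      rw [Finset.disjoint_left]
      intro e he he'
      have hv : v ∈ e := by
        simp only [Finset.mem_insert, Finset.mem_singleton] at he'
        rcases he' with rfl | rfl | rfl <;> simp
      exact hvW ((mem_edgesIn.1 he).2 v hv)
    have h3 : ({s(v, x), s(v, y), s(v, z)} : Finset (Sym2 V)).card = 3 :=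
      Finset.card_eq_three.2 ⟨_, _, _, by simp [hxy, hx.ne'], by simp [hxz, hx.ne'],
        by simp [hyz, hy.ne'], rfl⟩
    rw [← h3, ← Finset.card_union_of_disjoint hd]
    refine Finset.card_le_card (Finset.union_subset (edgesIn_mono (Finset.subset_insert v W)) ?_)
    intro e he
    simp only [Finset.mem_insert, Finset.mem_singleton] at he
    rw [mem_edgesIn]
    rcases he with rfl | rfl | rfl
    · exact ⟨hx, by simp [hxW]⟩
    · exact ⟨hy, by simp [hyW]⟩
    · exact ⟨hz, by simp [hzW]⟩
  rw [Finset.card_insert_of_notMem hvW] at h1 h2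
  rcases hW with hW | hW
  · simp only [IsLamanTight] at hW; omega
  · simp only [IsColourTight] at hW; omega

end Tight

/-- Some vertex of a sparse graph can be reduced. -/
lemma IsSparse.exists_reducible {L : Type*} {S : Finset V} {G : SimpleGraph V} {U : Finset V}
    {ρ : V → L} (h : IsSparse S G U) (hG : ∀ a b, G.Adj a b → a ∈ S) (hUS : U ⊆ S)
    (hinj : Set.InjOn ρ U) (hS : S.Nonempty) :
    (∃ v ∈ S, (nbrs G v).card ≤ 1) ∨ (∃ v ∈ U, (nbrs G v).card = 2) ∨
    (∃ v ∈ U, (nbrs G v).card = 3 ∧ ∀ a ∈ S.erase v, ρ a ≠ ρ v) ∨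
    (∃ w ∈ S, w ∉ U ∧ (nbrs G w).card = 2 ∧ ∃ u ∈ U, ρ u = ρ w) := by
  classical
  by_contra! hcon
  obtain ⟨c1, c2, c3, c4⟩ := hcon
  set T := U.filter fun v => (nbrs G v).card = 3 with hT
  -- Every vertex of `T` has a partner outside `U` with the same label; partners are distinct and
  -- have degree at least three. Their surplus offsets the deficit of `T`, so the degree sum is at
  -- least 2|S| + 2|U|, while sparsity allows at most 2|S| + 2|U| - 2.
  have hex : ∀ v, ∃ a, v ∈ T → a ∈ S \ U ∧ ρ a = ρ v := by
    intro v
    by_cases hv : v ∈ T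
    · obtain ⟨hvU, hv3⟩ := Finset.mem_filter.1 hv
      obtain ⟨a, ha, hav⟩ := c3 v hvU hv3
      refine ⟨a, fun _ => ⟨Finset.mem_sdiff.2 ⟨Finset.mem_of_mem_erase ha, fun haU => ?_⟩, hav⟩⟩
      exact Finset.ne_of_mem_erase ha (hinj haU hvU hav)
    · exact ⟨v, fun h => absurd h hv⟩
  choose f hf using hex
  have hfinj : Set.InjOn f T := by
    intro a ha b hb hab
    refine hinj (Finset.mem_filter.1 ha).1 (Finset.mem_filter.1 hb).1 ?_
    rw [← (hf a ha).2, ← (hf b hb).2, hab]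
  have hWcard : (T.image f).card = T.card := Finset.card_image_of_injOn hfinj
  have hWsub : T.image f ⊆ S \ U := by
    intro a ha
    obtain ⟨b, hb, rfl⟩ := Finset.mem_image.1 ha
    exact (hf b hb).1
  have s1 : 4 * U.card ≤ ∑ v ∈ U, (nbrs G v).card + T.card := by
    rw [hT, Finset.card_filter, ← Finset.sum_add_distrib, mul_comm, ← smul_eq_mul,
      ← Finset.sum_const]
    refine Finset.sum_le_sum fun v hv => ?_
    have := c1 v (hUS hv)
    have := c2 v hv
    split_ifs <;> omega
  have s2 : 2 * (S \ U).card + T.card ≤ ∑ v ∈ S \ U, (nbrs G v).card := by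
    have e : T.card = ∑ v ∈ S \ U, if v ∈ T.image f then 1 else 0 := by
      rw [← hWcard, ← Finset.card_filter]
      congr 1
      ext a
      simp only [Finset.mem_filter]
      exact ⟨fun ha => ⟨hWsub ha, ha⟩, fun ha => ha.2⟩
    rw [e, mul_comm, ← smul_eq_mul, ← Finset.sum_const, ← Finset.sum_add_distrib]
    refine Finset.sum_le_sum fun v hv => ?_
    obtain ⟨hvS, hvU⟩ := Finset.mem_sdiff.1 hv
    have k1 := c1 v hvS
    split_ifs with hvW
    · obtain ⟨b, hb, rfl⟩ := Finset.mem_image.1 hvW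
      have : (nbrs G (f b)).card ≠ 2 := fun h2 =>
        c4 _ hvS hvU h2 b (Finset.mem_filter.1 hb).1 (hf b hb).2.symm
      omega
    · omega
  have s3 := sum_card_nbrs hG
  rw [← Finset.sum_sdiff hUS] at s3
  have s4 := h.forest S subset_rfl hS
  rw [Finset.inter_eq_left.2 hUS] at s4
  have s5 := Finset.card_sdiff_add_card_eq_card hUS
  omega

/-- A sparse graph has a stress-free framework that respects the labels. -/
theorem IsSparse.exists_stressFree {K L : Type*} [Field K] [CharZero K] [DecidableEq L]
    [Infinite L] {S : Finset V} {G : SimpleGraph V} {U : Finset V}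
    {ρ : V → L} (h : IsSparse S G U) (hG : ∀ a b, G.Adj a b → a ∈ S) (hUS : U ⊆ S)
    (hinj : Set.InjOn ρ U) :
    ∃ p : V → K × K, IsAdmissible S ρ p ∧ StressFree S G U ρ p := by
  classical
  -- A lexicographic measure: first the number of joints, then the number of vertices outside `U`
  -- whose label occurs in `U`. The factor `Fintype.card V + 1` exceeds any value of the second
  -- count.
  induction hN : S.card * (Fintype.card V + 1) +
      (Finset.univ.filter fun w => w ∉ U ∧ ∃ u ∈ U, ρ u = ρ w).card using
      Nat.strong_induction_on generalizing S G U ρ with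
  | _ N ih =>
  subst hN
  rcases S.eq_empty_or_nonempty with rfl | hS
  · refine ⟨0, ⟨by simp, by simp, by simp, by simp⟩, fun ω l hs _ u v => hs.supp u v fun hadj => ?_⟩
    simpa using hG u v hadj
  have hGd : ∀ v a b, (VariableSpheres.del G v).Adj a b → a ∈ S.erase v := fun v a b hab =>
    Finset.mem_erase.2 ⟨hab.2.1, hG a b hab.1⟩
  have hlt : ∀ v ∈ S, ∀ U' : Finset V, (S.erase v).card * (Fintype.card V + 1) +
      (Finset.univ.filter fun w => w ∉ U' ∧ ∃ u ∈ U', ρ u = ρ w).card <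
      S.card * (Fintype.card V + 1) +
      (Finset.univ.filter fun w => w ∉ U ∧ ∃ u ∈ U, ρ u = ρ w).card := by
    intro v hv U'
    rw [← Finset.card_erase_add_one hv, add_mul]
    have := Finset.card_le_univ (Finset.univ.filter fun w => w ∉ U' ∧ ∃ u ∈ U', ρ u = ρ w)
    omega
  have hinj' : ∀ v, Set.InjOn ρ (U.erase v : Finset V) := fun v =>
    hinj.mono (Finset.coe_subset.2 (U.erase_subset v))
  have hdel : ∀ v ∈ S, ∃ p : V → K × K, IsAdmissible (S.erase v) ρ p ∧
      StressFree (S.erase v) (VariableSpheres.del G v) (U.erase v) ρ p := fun v hv =>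
    ih _ (hlt v hv _) (h.del v) (hGd v) (Finset.erase_subset_erase v hUS) (hinj' v) rfl
  have mem : ∀ {v a}, G.Adj v a → a ∈ S.erase v := fun {v a} ha =>
    Finset.mem_erase.2 ⟨ha.ne', hG a v ha.symm⟩
  rcases h.exists_reducible hG hUS hinj hS with ⟨v, hv, hd⟩ | ⟨v, hv, hd⟩ | ⟨v, hv, hd, hlab⟩ |
    ⟨w, hw, hwU, hd, u, hu, huw⟩
  · obtain ⟨p, hp, hf⟩ := hdel v hv
    have : Nonempty V := ⟨v⟩
    obtain ⟨x, hx⟩ := Finset.card_le_one_iff_subset_singleton.1 hd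
    exact hf.exists_extend_pendant hG hp fun a ha => Finset.mem_singleton.1 (hx (mem_nbrs.2 ha))
  · obtain ⟨p, hp, hf⟩ := hdel v (hUS hv)
    obtain ⟨x, y, hxy, hxy'⟩ := Finset.card_eq_two.1 hd
    have hN : ∀ a, G.Adj v a ↔ a = x ∨ a = y := fun a => by rw [← mem_nbrs, hxy']; simp
    obtain ⟨s, h1, h2⟩ := hf.exists_extend_two hinj hp (mem ((hN x).2 (Or.inl rfl)))
      (mem ((hN y).2 (Or.inr rfl))) hxy (fun a => (hN a).1) hv rfl
    exact ⟨_, h1, h2⟩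
  · obtain ⟨x, y, z, hxy, hxz, hyz, hxyz⟩ := Finset.card_eq_three.1 hd
    have hN : ∀ a, G.Adj v a ↔ a = x ∨ a = y ∨ a = z := fun a => by rw [← mem_nbrs, hxyz]; simp
    have hx := (hN x).2 (by simp)
    have hy := (hN y).2 (by simp)
    have hz := (hN z).2 (by simp)
    have main : ∀ {a b c : V}, a ≠ b → a ≠ c → b ≠ c → G.Adj v a → G.Adj v b → G.Adj v c →
        (∀ d, G.Adj v d → d = a ∨ d = b ∨ d = c) → ¬ G.Adj a b →
        IsSparse (S.erase v) (VariableSpheres.del G v ⊔ SimpleGraph.edge a b) (U.erase v) →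
        ∃ p : V → K × K, IsAdmissible S ρ p ∧ StressFree S G U ρ p := by
      intro a b c hab hac hbc ha hb hc hall hadj hsp
      obtain ⟨p, hp, hf⟩ := ih _ (hlt v (hUS hv) (U.erase v)) hsp (fun d e hde => by
        rcases hde with h1 | h1
        · exact hGd v d e h1
        · rcases ((SimpleGraph.edge_adj _ _ _ _).1 h1).1 with ⟨rfl, rfl⟩ | ⟨rfl, rfl⟩
          · exact mem ha
          · exact mem hb) (Finset.erase_subset_erase v hUS) (hinj' v) rfl
      exact hf.exists_extend_three hp (mem ha) (mem hb) (mem hc) hab hac hbc hall hv hlab hadj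
    rcases h.exists_sup_edge hG hv hxy hxz hyz hx hy hz with ⟨h1, h2⟩ | ⟨h1, h2⟩ | ⟨h1, h2⟩
    · exact main hxy hxz hyz hx hy hz (fun d hd => (hN d).1 hd) h1 h2
    · exact main hyz hxy.symm hxz.symm hy hz hx (fun d hd => by have := (hN d).1 hd; tauto) h1 h2
    · exact main hxz hxy hyz.symm hx hz hy (fun d hd => by have := (hN d).1 hd; tauto) h1 h2
  · obtain ⟨x, y, hxy, hxy'⟩ := Finset.card_eq_two.1 hd
    have hN : ∀ a, G.Adj w a ↔ a = x ∨ a = y := fun a => by rw [← mem_nbrs, hxy']; simp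
    -- A fresh label removes `w` from the class of `u`, which lowers the second part of the measure.
    obtain ⟨c, hc⟩ := Infinite.exists_notMem_finset (Finset.univ.image ρ)
    have hc' : ∀ a, c ≠ ρ a := fun a hca => hc (by rw [hca]; simp)
    set ρ' := Function.update ρ w c with hρ'
    have hρ : ∀ a, a ≠ w → ρ' a = ρ a := fun a ha => by simp [hρ', ha]
    have hw' : ρ' w = c := by simp [hρ']
    have hUw : ∀ a ∈ U, a ≠ w := fun a ha haw => hwU (haw ▸ ha)
    have hinjU : Set.InjOn ρ' U := by
      intro a ha b hb hab
      rw [hρ a (hUw a ha), hρ b (hUw b hb)] at hab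
      exact hinj ha hb hab
    have hcard : (Finset.univ.filter fun a => a ∉ U ∧ ∃ u ∈ U, ρ' u = ρ' a).card <
        (Finset.univ.filter fun a => a ∉ U ∧ ∃ u ∈ U, ρ u = ρ a).card := by
      refine Finset.card_lt_card ((Finset.ssubset_iff_of_subset ?_).2 ⟨w, ?_, ?_⟩)
      · intro a
        simp only [Finset.mem_filter, Finset.mem_univ, true_and]
        rintro ⟨haU, b, hb, hba⟩
        refine ⟨haU, b, hb, ?_⟩
        by_cases haw : a = w
        · rw [haw, hw', hρ b (hUw b hb)] at hba
          exact absurd hba.symm (hc' b)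
        · rwa [hρ a haw, hρ b (hUw b hb)] at hba
      · simpa using ⟨hwU, u, hu, huw⟩
      · simp only [Finset.mem_filter, Finset.mem_univ, true_and, not_and, not_exists]
        intro _ b hb hbw
        rw [hw', hρ b (hUw b hb)] at hbw
        exact hc' b hbw.symm
    obtain ⟨p, hp, hf⟩ := ih _ (Nat.add_lt_add_left hcard _) h hG hUS hinjU rfl
    exact hf.exists_relabel hG hinj hwU hρ (fun a _ => by rw [hw']; exact hc' a) hu huw
      ((hN x).2 (Or.inl rfl)) ((hN y).2 (Or.inr rfl)) hxy (fun a => (hN a).1) hp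

end Counting

/-! ### The rank of the graphic matroid as a dimension. -/

section GraphicRank

variable {V : Type*} [Fintype V] [DecidableEq V]

/-- The space spanned by the differences of the endpoints of the edges in `F`. -/
def cutSpace (F : Set (Sym2 V)) : Submodule ℝ (V → ℝ) :=
  Submodule.span ℝ {x | ∃ u v, s(u, v) ∈ F ∧ x = Pi.single u 1 - Pi.single v 1}

/-- The rank of `F` in the graphic matroid. -/
noncomputable def graphicRank (F : Set (Sym2 V)) : ℕ := Module.finrank ℝ (cutSpace F)

lemma single_sub_single_mem_cutSpace {F : Set (Sym2 V)} {u v : V}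
    (h : (SimpleGraph.fromEdgeSet F).Reachable u v) :
    (Pi.single u 1 - Pi.single v 1 : V → ℝ) ∈ cutSpace F := by
  obtain ⟨w⟩ := h
  induction w with
  | nil => simp
  | cons hadj _ ih =>
    rw [← sub_add_sub_cancel]
    exact Submodule.add_mem _
      (Submodule.subset_span ⟨_, _, ((SimpleGraph.fromEdgeSet_adj F).1 hadj).1, rfl⟩) ih

/-- Totals over the components define a surjection onto the functions on components, and its kernel
is spanned by the edge differences. -/
lemma graphicRank_add_numComponents (F : Set (Sym2 V)) :
    graphicRank F + numComponents F = Fintype.card V := by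
  classical
  set H := SimpleGraph.fromEdgeSet F with hH
  let mk := H.connectedComponentMk
  let rep : H.ConnectedComponent → V := fun c => Quot.out c
  have hrep : ∀ c, mk (rep c) = c := fun c => Quot.out_eq c
  let σ : (V → ℝ) →ₗ[ℝ] (H.ConnectedComponent → ℝ) :=
    { toFun := fun f c => ∑ v, if mk v = c then f v else 0
      map_add' := by
        intro f g; ext c
        simp only [Pi.add_apply, ← Finset.sum_add_distrib]
        exact Finset.sum_congr rfl fun v _ => by split_ifs <;> simp
      map_smul' := by
        intro a f; ext c
        simp only [Pi.smul_apply, smul_eq_mul, RingHom.id_apply, Finset.mul_sum]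
        exact Finset.sum_congr rfl fun v _ => by split_ifs <;> simp }
  have hσ : ∀ f c, σ f c = ∑ v, if mk v = c then f v else 0 := fun f c => rfl
  have hsurj : Function.Surjective σ := by
    intro g
    refine ⟨fun v => if v = rep (mk v) then g (mk v) else 0, ?_⟩
    ext c
    rw [hσ, Finset.sum_eq_single (rep c)]
    · simp [hrep]
    · intro v _ hv
      split_ifs with h1 h2
      · rw [h1] at h2; exact absurd h2 hv
      · rfl
      · rfl
    · simp
  have hker : LinearMap.ker σ = cutSpace F := by
    apply le_antisymm
    · intro f hf
      have hf' : ∀ c, ∑ v, (if mk v = c then f v else 0) = 0 := fun c => by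
        rw [← hσ, LinearMap.mem_ker.1 hf, Pi.zero_apply]
      -- The representatives cancel because the total of `f` on every component is zero.
      have hdecomp : f = ∑ v, f v • (Pi.single v 1 - Pi.single (rep (mk v)) 1 : V → ℝ) := by
        ext w
        simp only [Finset.sum_apply, Pi.smul_apply, Pi.sub_apply, smul_eq_mul, mul_sub,
          Finset.sum_sub_distrib, Pi.single_apply, mul_ite, mul_one, mul_zero,
          Finset.sum_ite_eq, Finset.mem_univ, if_true]
        rw [eq_comm, sub_eq_self]
        by_cases hw : rep (mk w) = w
        · refine (Finset.sum_congr rfl fun v _ => ?_).trans (hf' (mk w))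
          have : w = rep (mk v) ↔ mk v = mk w :=
            ⟨fun h => by rw [h, hrep], fun h => by rw [h, hw]⟩
          by_cases hv : mk v = mk w
          · rw [if_pos hv, if_pos (this.2 hv)]
          · rw [if_neg hv, if_neg (this.not.2 hv)]
        · refine Finset.sum_eq_zero fun v _ => if_neg fun h => hw ?_
          rw [h, hrep]
      rw [hdecomp]
      refine Submodule.sum_mem _ fun v _ => Submodule.smul_mem _ _ ?_
      exact single_sub_single_mem_cutSpace (SimpleGraph.ConnectedComponent.exact (hrep (mk v)).symm)
    · refine Submodule.span_le.2 ?_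
      rintro _ ⟨u, v, huv, rfl⟩
      have hmk : mk u = mk v := by
        by_cases h : u = v
        · rw [h]
        · exact SimpleGraph.ConnectedComponent.sound
            ((SimpleGraph.fromEdgeSet_adj F).2 ⟨huv, h⟩).reachable
      rw [SetLike.mem_coe, LinearMap.mem_ker]
      ext c
      have h1 : ∀ a : V, σ (Pi.single a 1) c = if mk a = c then 1 else 0 := by
        intro a
        rw [hσ, Finset.sum_eq_single a]
        · simp
        · intro b _ hb; simp [hb]
        · simp
      rw [map_sub, Pi.sub_apply, h1, h1, hmk, sub_self, Pi.zero_apply]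
  have h1 := LinearMap.finrank_range_add_finrank_ker σ
  rw [LinearMap.range_eq_top.2 hsurj, finrank_top, hker, Module.finrank_fintype_fun_eq_card,
    Module.finrank_fintype_fun_eq_card] at h1
  rw [graphicRank, numComponents, Nat.card_eq_fintype_card, add_comm]
  exact h1

/-- Spans turn unions into sums and intersections into subspaces of the intersection, so the
dimension formula gives the inequality. -/
lemma graphicRank_submodular (F F' : Set (Sym2 V)) :
    graphicRank (F ∪ F') + graphicRank (F ∩ F') ≤ graphicRank F + graphicRank F' := by
  have h1 : cutSpace (F ∪ F') = cutSpace F ⊔ cutSpace F' := by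
    rw [cutSpace, cutSpace, cutSpace, ← Submodule.span_union]
    congr 1
    ext x
    simp only [Set.mem_ofPred_eq, Set.mem_union]
    constructor
    · rintro ⟨u, v, h | h, rfl⟩
      · exact Or.inl ⟨u, v, h, rfl⟩
      · exact Or.inr ⟨u, v, h, rfl⟩
    · rintro (⟨u, v, h, rfl⟩ | ⟨u, v, h, rfl⟩)
      · exact ⟨u, v, Or.inl h, rfl⟩
      · exact ⟨u, v, Or.inr h, rfl⟩
  have h2 : cutSpace (F ∩ F') ≤ cutSpace F ⊓ cutSpace F' := by
    refine le_inf (Submodule.span_mono ?_) (Submodule.span_mono ?_)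
    · rintro _ ⟨u, v, h, rfl⟩; exact ⟨u, v, h.1, rfl⟩
    · rintro _ ⟨u, v, h, rfl⟩; exact ⟨u, v, h.2, rfl⟩
  have h3 := Submodule.finrank_sup_add_finrank_inf_eq (cutSpace F) (cutSpace F')
  have h4 := Submodule.finrank_mono h2
  rw [← h1] at h3
  simp only [graphicRank]
  omega

lemma graphicRank_lt_card {F : Set (Sym2 V)} {X : Finset V} (hX : X.Nonempty)
    (hF : spanned F ⊆ X) : graphicRank F + 1 ≤ X.card := by
  obtain ⟨x, hx⟩ := hX
  have hle : cutSpace F ≤ Submodule.span ℝ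
      (((X.erase x).image fun u => (Pi.single u 1 - Pi.single x 1 : V → ℝ) : Finset (V → ℝ)) :
        Set (V → ℝ)) := by
    refine Submodule.span_le.2 ?_
    rintro _ ⟨u, v, huv, rfl⟩
    have key : ∀ a ∈ X, (Pi.single a 1 - Pi.single x 1 : V → ℝ) ∈ Submodule.span ℝ
        (((X.erase x).image fun u => (Pi.single u 1 - Pi.single x 1 : V → ℝ) : Finset (V → ℝ)) :
          Set (V → ℝ)) := by
      intro a ha
      by_cases hax : a = x
      · rw [hax, sub_self]; exact Submodule.zero_mem _
      · exact Submodule.subset_span (Finset.mem_coe.2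
          (Finset.mem_image_of_mem _ (Finset.mem_erase.2 ⟨hax, ha⟩)))
    have := Submodule.sub_mem _ (key u (hF ⟨_, huv, by simp⟩)) (key v (hF ⟨_, huv, by simp⟩))
    simpa using this
  have h1 := Submodule.finrank_mono hle
  have h2 := finrank_span_finset_le_card (R := ℝ)
    ((X.erase x).image fun u => (Pi.single u 1 - Pi.single x 1 : V → ℝ))
  have h3 : ((X.erase x).image fun u => (Pi.single u 1 - Pi.single x 1 : V → ℝ)).card ≤
      (X.erase x).card := Finset.card_image_le
  have h4 := Finset.card_erase_add_one hx
  simp only [graphicRank]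
  simp only [Set.finrank] at h2
  omega

end GraphicRank

/-! ### Choosing one representative for each colour. -/

section Uncolouring

variable {V C : Type*} [Fintype V] [DecidableEq V] [Finite C]

/-- The count given by the graphic rank and the number of colours. -/
def IsColourSparse (E : Set (Sym2 V)) (χ : V → Option C) : Prop :=
  ∀ F ⊆ E, F.ncard ≤ graphicRank F + numColoursOf χ F

/-- A violation can appear only where the number of colours drops. The drop is exactly one, so the
set was tight and v was the only vertex of its colour spanned by it. -/
lemma IsColourSparse.exists_tight {E : Set (Sym2 V)} {χ : V → Option C} (h : IsColourSparse E χ)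
    {v : V} {c : C} (hv : χ v = some c)
    (hnot : ¬ IsColourSparse E (Function.update χ v none)) :
    ∃ F ⊆ E, F.ncard = graphicRank F + numColoursOf χ F ∧ v ∈ spanned F ∧
      ∀ u ∈ spanned F, χ u = some c → u = v := by
  simp only [IsColourSparse, not_forall, not_le] at hnot
  obtain ⟨F, hFE, hF⟩ := hnot
  have h1 := h F hFE
  let K := {c : C | ∃ v ∈ spanned F, χ v = some c}
  let K' := {c : C | ∃ u ∈ spanned F, Function.update χ v none u = some c}
  have hK : numColoursOf χ F = K.ncard := rfl
  have hK' : numColoursOf (Function.update χ v none) F = K'.ncard := rfl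
  have hlt : K'.ncard < K.ncard := by omega
  have hsub : K ⊆ insert c K' := by
    rintro d ⟨u, hu, hud⟩
    by_cases huv : u = v
    · left; rw [huv, hv] at hud; exact (Option.some.inj hud).symm
    · right; exact ⟨u, hu, by rw [Function.update_of_ne huv, hud]⟩
  have hcK' : c ∉ K' := by
    intro hc
    rw [Set.insert_eq_of_mem hc] at hsub
    exact absurd (Set.ncard_le_ncard hsub) (by omega)
  have hle : K.ncard ≤ K'.ncard + 1 := by
    rw [← Set.ncard_insert_of_notMem hcK']
    exact Set.ncard_le_ncard hsub
  have huniq : ∀ u ∈ spanned F, χ u = some c → u = v := by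
    intro u hu huc
    by_contra huv
    exact hcK' ⟨u, hu, by rw [Function.update_of_ne huv, huc]⟩
  refine ⟨F, hFE, by omega, ?_, huniq⟩
  by_contra hvF
  have : K ⊆ K' := by
    rintro d ⟨u, hu, hud⟩
    exact ⟨u, hu, by rw [Function.update_of_ne (fun h => hvF (by rw [← h]; exact hu)), hud]⟩
  exact absurd (Set.ncard_le_ncard this) (by omega)

/-- One of two vertices of the same colour can lose its colour. -/
lemma IsColourSparse.uncolour {E : Set (Sym2 V)} {χ : V → Option C} (h : IsColourSparse E χ)
    {v w : V} {c : C} (hvw : v ≠ w) (hv : χ v = some c) (hw : χ w = some c) :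
    IsColourSparse E (Function.update χ v none) ∨ IsColourSparse E (Function.update χ w none) := by
  by_contra! hcon
  obtain ⟨F, hFE, hF, hvF, hFu⟩ := h.exists_tight hv hcon.1
  obtain ⟨F', hFE', hF', hwF', hFu'⟩ := h.exists_tight hw hcon.2
  have h1 := h (F ∪ F') (Set.union_subset hFE hFE')
  have h2 := h (F ∩ F') (Set.inter_subset_left.trans hFE)
  have h3 := graphicRank_submodular F F'
  have h4 := Set.ncard_union_add_ncard_inter F F'
  -- Colour `c` occurs on both `F` and `F'` but not on `F ∩ F'`, where a vertex of that colour would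
  -- equal both `v` and `w`. Submodularity is therefore strict, which contradicts the tightness of
  -- both sets.
  suffices h5 : numColoursOf χ (F ∪ F') + numColoursOf χ (F ∩ F') + 1 ≤
      numColoursOf χ F + numColoursOf χ F' by omega
  simp only [numColoursOf]
  set K := {c : C | ∃ v ∈ spanned F, χ v = some c} with hK
  set K' := {c : C | ∃ v ∈ spanned F', χ v = some c} with hK'
  have hun : {c : C | ∃ v ∈ spanned (F ∪ F'), χ v = some c} ⊆ K ∪ K' := by
    rintro d ⟨u, ⟨e, he | he, hue⟩, hud⟩
    · exact Or.inl ⟨u, ⟨e, he, hue⟩, hud⟩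
    · exact Or.inr ⟨u, ⟨e, he, hue⟩, hud⟩
  have hint : {c : C | ∃ v ∈ spanned (F ∩ F'), χ v = some c} ⊆ (K ∩ K') \ {c} := by
    rintro d ⟨u, ⟨e, he, hue⟩, hud⟩
    refine ⟨⟨⟨u, ⟨e, he.1, hue⟩, hud⟩, ⟨u, ⟨e, he.2, hue⟩, hud⟩⟩, ?_⟩
    rintro rfl
    exact hvw ((hFu u ⟨e, he.1, hue⟩ hud).symm.trans (hFu' u ⟨e, he.2, hue⟩ hud))
  have hc : c ∈ K ∩ K' := ⟨⟨v, hvF, hv⟩, ⟨w, hwF', hw⟩⟩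
  have k1 := Set.ncard_le_ncard hun
  have k2 := Set.ncard_le_ncard hint
  have k3 := Set.ncard_union_add_ncard_inter K K'
  have k4 := Set.ncard_sdiff_singleton_add_one hc
  omega

/-- The colours of a sparse graph can be represented by single vertices. -/
lemma IsColourSparse.exists_injective {E : Set (Sym2 V)} {χ : V → Option C}
    (h : IsColourSparse E χ) :
    ∃ χ' : V → Option C, (∀ v, χ' v = none ∨ χ' v = χ v) ∧ IsColourSparse E χ' ∧
      ∀ u v c, χ' u = some c → χ' v = some c → u = v := by
  classical
  induction hn : (Finset.univ.filter fun v => χ v ≠ none).card using Nat.strong_induction_on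
    generalizing χ with
  | _ n ih =>
  subst hn
  by_cases hinj : ∀ u v c, χ u = some c → χ v = some c → u = v
  · exact ⟨χ, fun v => Or.inr rfl, h, hinj⟩
  push Not at hinj
  obtain ⟨u, v, c, hu, hv, huv⟩ := hinj
  have step : ∀ w, χ w = some c → IsColourSparse E (Function.update χ w none) →
      ∃ χ' : V → Option C, (∀ v, χ' v = none ∨ χ' v = χ v) ∧ IsColourSparse E χ' ∧
        ∀ u v c, χ' u = some c → χ' v = some c → u = v := by
    intro w hw hsp
    have hlt : (Finset.univ.filter fun v => Function.update χ w none v ≠ none).card <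
        (Finset.univ.filter fun v => χ v ≠ none).card := by
      refine Finset.card_lt_card ((Finset.ssubset_iff_of_subset ?_).2 ⟨w, by simp [hw], by simp⟩)
      intro a
      simp only [Finset.mem_filter, Finset.mem_univ, true_and]
      by_cases haw : a = w
      · simp [haw]
      · simp [haw]
    obtain ⟨χ', h1, h2, h3⟩ := ih _ hlt hsp rfl
    refine ⟨χ', fun a => ?_, h2, h3⟩
    rcases h1 a with h1 | h1
    · exact Or.inl h1
    · by_cases haw : a = w
      · left; rw [h1, haw]; simp
      · right; rw [h1]; simp [haw]
  rcases h.uncolour huv hu hv with h1 | h1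
  · exact step u hu h1
  · exact step v hv h1

lemma gOne_eq (χ : V → Option C) (F : Set (Sym2 V)) :
    gOne χ F = graphicRank F + min (numColoursOf χ F : ℤ) (((spanned F).ncard : ℤ) - 2) := by
  rw [gOne, ← graphicRank_add_numComponents F]
  push_cast
  ring

/-- A graph that satisfies the `gOne` counts is sparse with respect to suitable representatives
of the colours. -/
lemma exists_isSparse_of_le_gOne {G : SimpleGraph V} {χ : V → Option C}
    (h : ∀ F : Set (Sym2 V), F ⊆ G.edgeSet → F.Nonempty → (F.ncard : ℤ) ≤ gOne χ F) :
    ∃ U : Finset V, IsSparse Finset.univ G U ∧ (∀ u ∈ U, χ u ≠ none) ∧ Set.InjOn χ U := by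
  classical
  have hcs : IsColourSparse G.edgeSet χ := by
    intro F hF
    rcases F.eq_empty_or_nonempty with rfl | hne
    · simp
    · have h1 := h F hF hne
      rw [gOne_eq] at h1
      omega
  obtain ⟨χ', h1, h2, h3⟩ := hcs.exists_injective
  -- The graphic rank of the edges inside X is at most |X| - 1. The colour term gives the first
  -- count; the term |V(F)| - 2, which refers to the original colouring only through `gOne`, gives
  -- the second.
  refine ⟨Finset.univ.filter fun v => χ' v ≠ none, ⟨fun X _ hX => ?_, fun X _ hX => ?_⟩, ?_, ?_⟩
  · have hsp : spanned (edgesIn G X : Set (Sym2 V)) ⊆ X := by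
      rintro v ⟨e, he, hve⟩
      exact (mem_edgesIn.1 (Finset.mem_coe.1 he)).2 v hve
    have k1 := h2 (edgesIn G X) fun e he => (mem_edgesIn.1 (Finset.mem_coe.1 he)).1
    have k2 := graphicRank_lt_card hX hsp
    have k3 : numColoursOf χ' (edgesIn G X : Set (Sym2 V)) ≤
        ((Finset.univ.filter fun v => χ' v ≠ none) ∩ X).card := by
      rw [numColoursOf, ← Set.ncard_image_of_injective _ (Option.some_injective C)]
      refine le_trans ?_ (Finset.card_image_le (f := χ'))
      rw [← Set.ncard_coe_finset]
      refine Set.ncard_le_ncard ?_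
      rintro _ ⟨c, ⟨v, hv, hvc⟩, rfl⟩
      rw [Finset.mem_coe, Finset.mem_image]
      refine ⟨v, ?_, hvc⟩
      simp only [Finset.mem_inter, Finset.mem_filter, Finset.mem_univ, true_and, hvc]
      exact ⟨by simp, hsp hv⟩
    rw [Set.ncard_coe_finset] at k1
    omega
  · rcases (edgesIn G X).eq_empty_or_nonempty with he | he
    · rw [he, Finset.card_empty]; omega
    · have hsp : spanned (edgesIn G X : Set (Sym2 V)) ⊆ X := by
        rintro v ⟨e, he, hve⟩
        exact (mem_edgesIn.1 (Finset.mem_coe.1 he)).2 v hve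
      have k1 := h (edgesIn G X) (fun e he => (mem_edgesIn.1 (Finset.mem_coe.1 he)).1)
        (Finset.coe_nonempty.2 he)
      have k2 := graphicRank_lt_card (Finset.card_pos.1 (by omega)) hsp
      have k3 := Set.ncard_le_ncard hsp
      rw [gOne_eq] at k1
      rw [Set.ncard_coe_finset] at k1 k3
      omega
  · intro u hu
    have hu' := (Finset.mem_filter.1 hu).2
    rcases h1 u with h4 | h4
    · exact absurd h4 hu'
    · rwa [← h4]
  · intro u hu v hv huv
    have hu' := (Finset.mem_filter.1 hu).2
    have hv' := (Finset.mem_filter.1 hv).2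
    obtain ⟨c, hc⟩ := Option.ne_none_iff_exists'.1 hu'
    refine h3 u v c hc ?_
    rw [← hc, (h1 u).resolve_left hu', (h1 v).resolve_left hv']
    exact huv.symm

end Uncolouring

/-! ### Independence of rows through maximal minors. -/

section Minors

lemma exists_submatrix_det_ne_zero {m n K : Type*} [Field K] [Fintype m] [DecidableEq m]
    [Fintype n] {A : Matrix m n K} (h : LinearIndependent K A.row) :
    ∃ f : m → n, (A.submatrix id f).det ≠ 0 := by
  have hrank := h.rank_matrix
  rw [A.rank_eq_finrank_span_cols] at hrank
  obtain ⟨κ, a, ha, hspan, hli⟩ := exists_linearIndependent' K A.col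
  have : Finite κ := Finite.of_injective a ha
  have := Fintype.ofFinite κ
  rw [← hspan, finrank_span_eq_card hli] at hrank
  obtain ⟨e⟩ := Fintype.card_eq.1 hrank.symm
  refine ⟨a ∘ e, ?_⟩
  have hli' : LinearIndependent K (A.submatrix id (a ∘ e)).col := hli.comp e e.injective
  rw [Matrix.linearIndependent_cols_iff_isUnit] at hli'
  exact ((Matrix.isUnit_iff_isUnit_det _).1 hli').ne_zero

lemma linearIndependent_row_of_submatrix_det_ne_zero {m n K : Type*} [Field K] [Fintype m]
    [DecidableEq m] {A : Matrix m n K} {f : m → n} (h : (A.submatrix id f).det ≠ 0) :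
    LinearIndependent K A.row := by
  have h1 : LinearIndependent K (A.submatrix id f).row :=
    Matrix.linearIndependent_rows_iff_isUnit.2
      ((Matrix.isUnit_iff_isUnit_det _).2 (isUnit_iff_ne_zero.2 h))
  exact LinearIndependent.of_comp (LinearMap.funLeft K K f) h1

end Minors

/-! ### The rigidity matrix over a ring and its row dependencies. -/

section RigidityMatrix

variable {V C R : Type*} [DecidableEq V] [DecidableEq C] [CommRing R]

/-- The entries of the rows of the edges, over an arbitrary ring. -/
def edgeCoeff (z : V → Fin 2 → R) (e : Sym2 V) (v : V) (a : Fin 2) : R :=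
  Sym2.lift ⟨fun i j => (if v = i then z i a - z j a else 0) + (if v = j then z j a - z i a else 0),
    fun _ _ => add_comm _ _⟩ e

/-- The rigidity matrix over an arbitrary ring. -/
def rigidityMatrixOver (G : SimpleGraph V) (χ : V → Option C) (z : V → Fin 2 → R) :
    Matrix (G.edgeSet ⊕ V) ((V × Fin 2) ⊕ C) R :=
  Matrix.fromBlocks
    (Matrix.of fun e x => edgeCoeff z e.1 x.1 x.2)
    0
    (Matrix.of fun v x => if x.1 = v then z v x.2 else 0)
    (Matrix.of fun v c => if χ v = some c then 1 else 0)

lemma rigidityMatrix_eq (G : SimpleGraph V) (χ : V → Option C)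
    (p : V → EuclideanSpace ℝ (Fin 2)) :
    rigidityMatrix (d := 1) G χ p = rigidityMatrixOver G χ fun v a => p v a := rfl

lemma rigidityMatrixOver_map {R' : Type*} [CommRing R'] (φ : R →+* R') (G : SimpleGraph V)
    (χ : V → Option C) (z : V → Fin 2 → R) :
    (rigidityMatrixOver G χ z).map φ = rigidityMatrixOver G χ fun v a => φ (z v a) := by
  ext (⟨e, he⟩ | v) (⟨x, a⟩ | c)
  · induction e using Sym2.ind with
    | _ i j => simp [rigidityMatrixOver, edgeCoeff, apply_ite φ]
  · simp [rigidityMatrixOver]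
  · simp [rigidityMatrixOver, apply_ite φ]
  · simp [rigidityMatrixOver, apply_ite φ]

/-- Written as a sum over possible neighbours, the entry lets a sum over edges become a sum over
vertices. -/
lemma edgeCoeff_eq_sum [Fintype V] (z : V → Fin 2 → R) (e : Sym2 V) (v : V) (a : Fin 2) :
    edgeCoeff z e v a = ∑ u, if e = s(v, u) then z v a - z u a else 0 := by
  induction e using Sym2.ind with
  | _ i j =>
  simp only [edgeCoeff, Sym2.lift_mk]
  have key : ∀ u, (if s(i, j) = s(v, u) then z v a - z u a else 0) =
      (if u = j then if v = i then z i a - z j a else 0 else 0) +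
        if u = i then if v = j then z j a - z i a else 0 else 0 := by
    intro u
    simp only [Sym2.eq_iff]
    split_ifs <;> grind
  simp only [key, Finset.sum_add_distrib, Finset.sum_ite_eq', Finset.mem_univ, if_true]

/-- Linear dependencies between the rows are stresses whose loads are balanced on every colour. -/
lemma linearIndependent_row_iff [Fintype V] (G : SimpleGraph V) (χ : V → Option C)
    (z : V → Fin 2 → R) :
    LinearIndependent R (rigidityMatrixOver G χ z).row ↔
      ∀ (ω : V → V → R) (l : V → R), (∀ u v, ω u v = ω v u) → (∀ u v, ¬ G.Adj u v → ω u v = 0) →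
        (∀ v a, ∑ u, ω u v * (z u a - z v a) = l v * z v a) →
        (∀ c, ∑ v, (if χ v = some c then l v else 0) = 0) →
        (∀ u v, ω u v = 0) ∧ ∀ v, l v = 0 := by
  classical
  have : Fintype G.edgeSet := Fintype.ofFinite _
  have key : ∀ (g : Sym2 V → R) (l : V → R), (∀ e ∉ G.edgeSet, g e = 0) →
      ((∑ i, (Sum.elim (fun e : G.edgeSet => g e.1) l i) • (rigidityMatrixOver G χ z).row i = 0) ↔
      (∀ v a, ∑ u, g s(u, v) * (z u a - z v a) = l v * z v a) ∧
        ∀ c, ∑ v, (if χ v = some c then l v else 0) = 0) := by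
    intro g l hg
    rw [funext_iff, Sum.forall, Prod.forall]
    refine and_congr (forall_congr' fun v => forall_congr' fun a => ?_) (forall_congr' fun c => ?_)
    · have h1 : ∑ e : G.edgeSet, g e.1 * edgeCoeff z e.1 v a =
          ∑ u, g s(u, v) * (z v a - z u a) := by
        simp only [edgeCoeff_eq_sum, Finset.mul_sum]
        rw [Finset.sum_comm]
        refine Finset.sum_congr rfl fun u _ => ?_
        rw [show s(v, u) = s(u, v) from Sym2.eq_swap]
        by_cases hu : s(u, v) ∈ G.edgeSet
        · rw [Finset.sum_eq_single ⟨s(u, v), hu⟩ _ (by simp)]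
          · rw [if_pos rfl]
          · intro e _ he
            rw [if_neg fun h => he (Subtype.ext h), mul_zero]
        · rw [hg _ hu, zero_mul]
          exact Finset.sum_eq_zero fun e _ => by
            rw [if_neg fun h : e.1 = s(u, v) => hu (h ▸ e.2), mul_zero]
      simp only [Fintype.sum_sum_type, Sum.elim_inl, Sum.elim_inr, Finset.sum_apply,
        Pi.smul_apply, smul_eq_mul, Pi.zero_apply, Matrix.row, rigidityMatrixOver,
        Matrix.fromBlocks_apply₁₁, Matrix.fromBlocks_apply₂₁, Matrix.of_apply, mul_ite, mul_zero,
        Finset.sum_ite_eq, Finset.mem_univ, if_true, h1]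
      rw [← neg_eq_iff_add_eq_zero, ← Finset.sum_neg_distrib]
      simp only [← mul_neg, neg_sub]
    · simp only [Fintype.sum_sum_type, Sum.elim_inl, Sum.elim_inr, Finset.sum_apply,
        Pi.smul_apply, smul_eq_mul, Pi.zero_apply, Matrix.row, rigidityMatrixOver,
        Matrix.fromBlocks_apply₁₂, Matrix.fromBlocks_apply₂₂, Matrix.of_apply, Matrix.zero_apply,
        mul_zero, mul_ite, mul_one, Finset.sum_const_zero, zero_add]
  rw [Fintype.linearIndependent_iff]
  constructor
  · intro h ω l hs hsupp heq hcol
    let g : Sym2 V → R := Sym2.lift ⟨ω, hs⟩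
    have hg : ∀ e ∉ G.edgeSet, g e = 0 := by
      intro e
      induction e using Sym2.ind with
      | _ i j => exact hsupp i j
    have h1 := h _ ((key g l hg).2 ⟨heq, hcol⟩)
    refine ⟨fun u v => ?_, fun v => h1 (Sum.inr v)⟩
    by_cases huv : G.Adj u v
    · exact h1 (Sum.inl ⟨s(u, v), huv⟩)
    · exact hsupp u v huv
  · intro h c hc
    let g : Sym2 V → R := fun e => if h : e ∈ G.edgeSet then c (Sum.inl ⟨e, h⟩) else 0
    have hg : ∀ e ∉ G.edgeSet, g e = 0 := fun e he => dif_neg he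
    have hcg : c = Sum.elim (fun e : G.edgeSet => g e.1) (fun v => c (Sum.inr v)) := by
      ext i
      rcases i with e | v
      · simp [g]
      · rfl
    rw [hcg] at hc
    have h1 := (key g _ hg).1 hc
    obtain ⟨h2, h3⟩ := h (fun u v => g s(u, v)) (fun v => c (Sum.inr v))
      (fun u v => by rw [Sym2.eq_swap]) (fun u v huv => hg _ huv) h1.1 h1.2
    rintro (⟨e, he⟩ | v)
    · have : g e = 0 := by
        induction e using Sym2.ind with
        | _ i j => exact h2 i j
      simpa [g, he] using this
    · exact h3 v

end RigidityMatrix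

/-! ### From one complex framework to every generic real one. -/

section Transfer

variable {V C : Type*} [Fintype V] [DecidableEq V] [Fintype C] [DecidableEq C]

/-- A generic framework is independent as soon as some complex framework with the same colouring
is. -/
lemma IsGeneric.isIndependent {G : SimpleGraph V} {χ : V → Option C} {r : C → ℝ}
    {p : V → EuclideanSpace ℝ (Fin 2)} (hgen : IsGeneric (d := 1) χ r p) {z : V → Fin 2 → ℂ}
    {s : C → ℂ}
    (hz : ∀ v, MvPolynomial.aeval (Sum.elim (fun x : V × Fin 2 => z x.1 x.2) s)
      (spherePoly 1 χ v) = 0)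
    (hli : LinearIndependent ℂ (rigidityMatrixOver G χ z).row) :
    IsIndependent (d := 1) G χ p := by
  classical
  have : Fintype G.edgeSet := Fintype.ofFinite _
  obtain ⟨f, hf⟩ := exists_submatrix_det_ne_zero hli
  let M : Matrix (G.edgeSet ⊕ V) ((V × Fin 2) ⊕ C) (MvPolynomial ((V × Fin 2) ⊕ C) ℚ) :=
    rigidityMatrixOver G χ fun v a => MvPolynomial.X (Sum.inl (v, a))
  have key : ∀ {K : Type} [Field K] [Algebra ℚ K] (y : V → Fin 2 → K) (t : C → K),
      MvPolynomial.aeval (Sum.elim (fun x : V × Fin 2 => y x.1 x.2) t) (M.submatrix id f).det =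
        ((rigidityMatrixOver G χ y).submatrix id f).det := by
    intro K _ _ y t
    rw [AlgHom.map_det, AlgHom.mapMatrix_apply, ← Matrix.submatrix_map]
    have := rigidityMatrixOver_map (MvPolynomial.aeval (R := ℚ)
      (Sum.elim (fun x : V × Fin 2 => y x.1 x.2) t)).toRingHom G χ
      (fun v a => MvPolynomial.X (Sum.inl (v, a)))
    simp only [AlgHom.toRingHom_eq_coe, RingHom.coe_coe, MvPolynomial.aeval_X, Sum.elim_inl] at this
    rw [← this]
  rw [IsIndependent, rigidityMatrix_eq]
  -- If the minor vanished at `(p, r)`, genericity would put it in the ideal of the circles, and it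
  -- would vanish at `(z, s)` as well.
  refine linearIndependent_row_of_submatrix_det_ne_zero (f := f) fun h0 => hf ?_
  rw [← key _ r] at h0
  have hmem := hgen _ h0
  rw [← key z s]
  have hle : Ideal.span (Set.range (spherePoly 1 χ)) ≤ RingHom.ker
      (MvPolynomial.aeval (R := ℚ) (Sum.elim (fun x : V × Fin 2 => z x.1 x.2) s)) := by
    rw [Ideal.span_le]
    rintro _ ⟨v, rfl⟩
    exact hz v
  exact hle hmem

/-- A generic framework that satisfies the `gOne` counts is independent. -/
theorem IsGeneric.isIndependent_of_le_gOne {G : SimpleGraph V} {χ : V → Option C} {r : C → ℝ}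
    {p : V → EuclideanSpace ℝ (Fin 2)} (hgen : IsGeneric (d := 1) χ r p)
    (h : ∀ F : Set (Sym2 V), F ⊆ G.edgeSet → F.Nonempty → (F.ncard : ℤ) ≤ gOne χ F) :
    IsIndependent (d := 1) G χ p := by
  obtain ⟨U, hU, hUc, hinj⟩ := exists_isSparse_of_le_gOne h
  -- The factor `ℕ` supplies the infinitely many labels used for relabelling. The uncoloured
  -- vertices form a class of their own.
  obtain ⟨q, hq, hfree⟩ := hU.exists_stressFree (K := ℂ) (ρ := (fun v => (χ v, 0) : V → Option C × ℕ))
    (fun a _ _ => Finset.mem_univ a) (Finset.subset_univ U)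
    (fun u hu v hv huv => hinj hu hv (congrArg Prod.fst huv))
  have hnorm : ∀ u v, χ u = χ v → norm2 (q u) = norm2 (q v) := fun u v huv =>
    (hq.norm_eq u (Finset.mem_univ u) v (Finset.mem_univ v)).2 (by simp only [huv])
  have hne : ∀ v, norm2 (q v) ≠ 0 := fun v => hq.norm_ne v (Finset.mem_univ v)
  -- A common scaling gives the uncoloured class squared radius one.
  obtain ⟨τ, hτ0, hτ⟩ : ∃ τ : ℂ, τ ≠ 0 ∧ ∀ v, χ v = none → τ ^ 2 * norm2 (q v) = 1 := by
    by_cases hex : ∃ w, χ w = none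
    · obtain ⟨w, hw⟩ := hex
      obtain ⟨τ, hτ⟩ := IsAlgClosed.exists_pow_nat_eq (norm2 (q w))⁻¹ zero_lt_two
      refine ⟨τ, ?_, fun v hv => ?_⟩
      · rintro rfl
        exact inv_ne_zero (hne w) (by rw [← hτ]; simp)
      · rw [hτ, hnorm v w (hv.trans hw.symm), inv_mul_cancel₀ (hne w)]
    · exact ⟨1, one_ne_zero, fun v hv => absurd ⟨v, hv⟩ hex⟩
  have hs : ∀ c, ∃ s : ℂ, ∀ v, χ v = some c → s ^ 2 = τ ^ 2 * norm2 (q v) := by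
    intro c
    by_cases hex : ∃ w, χ w = some c
    · obtain ⟨w, hw⟩ := hex
      obtain ⟨s, hs⟩ := IsAlgClosed.exists_pow_nat_eq (τ ^ 2 * norm2 (q w)) zero_lt_two
      exact ⟨s, fun v hv => by rw [hs, hnorm v w (hv.trans hw.symm)]⟩
    · exact ⟨0, fun v hv => absurd ⟨v, hv⟩ hex⟩
  choose s hs using hs
  -- The passage back from isotropic coordinates: z₀ + i z₁ and z₀ - i z₁ are τ times the
  -- coordinates of `q v`.
  let z : V → Fin 2 → ℂ := fun v =>
    ![τ * ((q v).1 + (q v).2) / 2, τ * ((q v).2 - (q v).1) * Complex.I / 2]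
  have hz0 : ∀ v, z v 0 = τ * ((q v).1 + (q v).2) / 2 := fun v => rfl
  have hz1 : ∀ v, z v 1 = τ * ((q v).2 - (q v).1) * Complex.I / 2 := fun v => rfl
  have hsq : ∀ v, z v 0 ^ 2 + z v 1 ^ 2 = τ ^ 2 * norm2 (q v) := by
    intro v
    rw [hz0, hz1, norm2]
    linear_combination τ ^ 2 * ((q v).2 - (q v).1) ^ 2 / 4 * Complex.I_sq
  refine hgen.isIndependent (z := z) (s := s) (fun v => ?_) ?_
  · rcases hv : χ v with _ | c
    · simp [spherePoly, hv, Fin.sum_univ_two, hsq, hτ v hv]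
    · simp [spherePoly, hv, Fin.sum_univ_two, hsq, hs c v hv]
  · rw [linearIndependent_row_iff]
    intro ω l hsymm hsupp heq hcol
    have heq' : ∀ v, ∑ u, ω u v • (q u - q v) = l v • q v := by
      intro v
      have e0 := heq v 0
      have e1 := heq v 1
      ext
      · simp only [Prod.fst_sum, Prod.smul_fst, Prod.fst_sub, smul_eq_mul]
        refine mul_left_cancel₀ hτ0 ?_
        have : ∀ u, τ * (ω u v * ((q u).1 - (q v).1)) =
            ω u v * (z u 0 - z v 0) + Complex.I * (ω u v * (z u 1 - z v 1)) := by
          intro u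
          simp only [hz0, hz1]
          linear_combination -(τ * ω u v * ((q u).2 - (q u).1 - (q v).2 + (q v).1)) / 2 *
            Complex.I_sq
        rw [Finset.mul_sum, Finset.sum_congr rfl fun u _ => this u, Finset.sum_add_distrib,
          ← Finset.mul_sum, e0, e1, hz0, hz1]
        linear_combination τ * l v * ((q v).2 - (q v).1) / 2 * Complex.I_sq
      · simp only [Prod.snd_sum, Prod.smul_snd, Prod.snd_sub, smul_eq_mul]
        refine mul_left_cancel₀ hτ0 ?_
        have : ∀ u, τ * (ω u v * ((q u).2 - (q v).2)) =
            ω u v * (z u 0 - z v 0) - Complex.I * (ω u v * (z u 1 - z v 1)) := by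
          intro u
          simp only [hz0, hz1]
          linear_combination (τ * ω u v * ((q u).2 - (q u).1 - (q v).2 + (q v).1)) / 2 *
            Complex.I_sq
        rw [Finset.mul_sum, Finset.sum_congr rfl fun u _ => this u, Finset.sum_sub_distrib,
          ← Finset.mul_sum, e0, e1, hz0, hz1]
        linear_combination -τ * l v * ((q v).2 - (q v).1) / 2 * Complex.I_sq
    have hω : ∀ u v, ω u v = 0 := by
      refine hfree ω l ⟨hsymm, hsupp, fun v hv => absurd (Finset.mem_univ v) hv, heq'⟩ ?_
      intro u hu
      obtain ⟨c, hc⟩ := Option.ne_none_iff_exists'.1 (hUc u hu)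
      simpa only [hc, Prod.mk.injEq, and_true] using hcol c
    refine ⟨hω, fun v => ?_⟩
    have h1 := heq' v
    simp only [hω, zero_smul, Finset.sum_const_zero] at h1
    refine (smul_eq_zero.1 h1.symm).resolve_right fun h2 => hne v ?_
    simp [norm2, h2]

end Transfer

/-! ### Necessity of the counts: moments and radial loads. -/

section Necessity

variable {V C : Type*} [Fintype V] [DecidableEq V] [Fintype C] [DecidableEq C]

lemma IsGeneric.cross_ne {χ : V → Option C} {r : C → ℝ} {p : V → EuclideanSpace ℝ (Fin 2)}
    (hgen : IsGeneric (d := 1) χ r p) {u v : V} (huv : u ≠ v) :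
    p u 0 * p v 1 - p u 1 * p v 0 ≠ 0 := by
  intro h0
  let f : MvPolynomial ((V × Fin 2) ⊕ C) ℚ :=
    MvPolynomial.X (Sum.inl (u, 0)) * MvPolynomial.X (Sum.inl (v, 1)) -
      MvPolynomial.X (Sum.inl (u, 1)) * MvPolynomial.X (Sum.inl (v, 0))
  have hf : f ∈ Ideal.span (Set.range (spherePoly 1 χ)) := hgen f (by simpa [f] using h0)
  -- A rational framework on unit circles where the determinant is one, so its polynomial is not in
  -- the ideal.
  let q : V → Fin 2 → ℚ := fun w => if w = v then ![0, 1] else ![1, 0]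
  have hle : Ideal.span (Set.range (spherePoly 1 χ)) ≤ RingHom.ker
      (MvPolynomial.aeval (R := ℚ) (Sum.elim (fun x : V × Fin 2 => q x.1 x.2)
        (fun _ : C => (1 : ℚ)))) := by
    rw [Ideal.span_le]
    rintro _ ⟨w, rfl⟩
    rw [SetLike.mem_coe, RingHom.mem_ker]
    by_cases hw : w = v <;> rcases hc : χ w with _ | c <;>
      simp [spherePoly, hc, Fin.sum_univ_two, q, hw]
    all_goals subst hw; simp [hc]
  have := hle hf
  rw [RingHom.mem_ker] at this
  simp [f, q, huv] at this

lemma IsFramework.sq_add_sq_ne_zero {χ : V → Option C} {r : C → ℝ}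
    {p : V → EuclideanSpace ℝ (Fin 2)} (hp : IsFramework (d := 1) χ r p) (v : V) :
    p v 0 ^ 2 + p v 1 ^ 2 ≠ 0 := by
  have h1 : ‖p v‖ = radius r (χ v) := by simpa using hp.mem_sphere v
  have h2 : 0 < radius r (χ v) := by
    rcases χ v with _ | c
    · exact one_pos
    · exact hp.radius_pos c
  have h3 := EuclideanSpace.real_norm_sq_eq (p v)
  rw [Fin.sum_univ_two] at h3
  rw [← h3, h1]
  positivity

/-- Edge weights on `F`, extended by zero. -/
def extendWeights (F : Set (Sym2 V)) [DecidablePred (· ∈ F)] : (F → ℝ) →ₗ[ℝ] (Sym2 V → ℝ) where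
  toFun g e := if h : e ∈ F then g ⟨e, h⟩ else 0
  map_add' g g' := by ext e; by_cases h : e ∈ F <;> simp [h]
  map_smul' c g := by ext e; by_cases h : e ∈ F <;> simp [h]

/-- The moments about the origin of the resultants at the vertices. -/
def moments (z : V → Fin 2 → ℝ) : (Sym2 V → ℝ) →ₗ[ℝ] (V → ℝ) where
  toFun g v := ∑ u, g s(u, v) * (z u 0 * z v 1 - z u 1 * z v 0)
  map_add' g g' := by ext v; simp [add_mul, Finset.sum_add_distrib]
  map_smul' c g := by ext v; simp [Finset.mul_sum, mul_assoc]

/-- The radial components of the resultants at the vertices. -/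
noncomputable def radialLoads (z : V → Fin 2 → ℝ) : (Sym2 V → ℝ) →ₗ[ℝ] (V → ℝ) where
  toFun g v := (∑ u, g s(u, v) * ((z u 0 - z v 0) * z v 0 + (z u 1 - z v 1) * z v 1)) /
    (z v 0 ^ 2 + z v 1 ^ 2)
  map_add' g g' := by ext v; simp [add_mul, Finset.sum_add_distrib, add_div]
  map_smul' c g := by ext v; simp [Finset.mul_sum, mul_assoc, ← mul_div_assoc]

/-- An edge contributes opposite moments at its two ends. In the double sum every edge appears in
both orientations, hence the factor 1/2. -/
lemma moments_mem_cutSpace (z : V → Fin 2 → ℝ) {F : Set (Sym2 V)} {g : Sym2 V → ℝ}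
    (hg : ∀ e ∉ F, g e = 0) : moments z g ∈ cutSpace F := by
  have key : moments z g = ∑ u, ∑ v, (g s(u, v) * (z u 0 * z v 1 - z u 1 * z v 0) / 2) •
      (Pi.single v 1 - Pi.single u 1 : V → ℝ) := by
    ext w
    simp only [Finset.sum_apply, Pi.smul_apply, Pi.sub_apply, Pi.single_apply, smul_eq_mul, mul_sub,
      Finset.sum_sub_distrib, mul_ite, mul_one, mul_zero, Finset.sum_ite_eq, Finset.mem_univ,
      if_true]
    rw [Finset.sum_comm (f := fun u v => if w = u then _ else _)]
    simp only [Finset.sum_ite_eq, Finset.mem_univ, if_true]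
    rw [← Finset.sum_sub_distrib]
    refine Finset.sum_congr rfl fun u _ => ?_
    rw [show s(w, u) = s(u, w) from Sym2.eq_swap]
    ring
  rw [key]
  refine Submodule.sum_mem _ fun u _ => Submodule.sum_mem _ fun v _ => ?_
  by_cases huv : s(u, v) ∈ F
  · refine Submodule.smul_mem _ _ (Submodule.subset_span ⟨v, u, ?_, rfl⟩)
    rwa [Sym2.eq_swap]
  · rw [hg _ huv, zero_mul, zero_div, zero_smul]
    exact Submodule.zero_mem _

/-- A resultant of zero moment is parallel to the nonzero position vector, and the coefficient is
found by projection. -/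
lemma sum_mul_sub_eq_radialLoads {z : V → Fin 2 → ℝ} (hz : ∀ v, z v 0 ^ 2 + z v 1 ^ 2 ≠ 0)
    {g : Sym2 V → ℝ} (hg : moments z g = 0) (v : V) (a : Fin 2) :
    ∑ u, g s(u, v) * (z u a - z v a) = radialLoads z g v * z v a := by
  have h0 : ∑ u, g s(u, v) * (z u 0 * z v 1 - z u 1 * z v 0) = 0 := congrFun hg v
  have h1 : radialLoads z g v * (z v 0 ^ 2 + z v 1 ^ 2) =
      ∑ u, g s(u, v) * ((z u 0 - z v 0) * z v 0 + (z u 1 - z v 1) * z v 1) :=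
    div_mul_cancel₀ _ (hz v)
  refine mul_right_cancel₀ (hz v) ?_
  rw [mul_right_comm, h1]
  fin_cases a
  · simp only [Fin.zero_eta]
    rw [← add_zero (_ * z v 0), ← zero_mul (z v 1), ← h0, Finset.sum_mul, Finset.sum_mul,
      Finset.sum_mul, ← Finset.sum_add_distrib]
    exact Finset.sum_congr rfl fun u _ => by ring
  · simp only [Fin.mk_one]
    rw [← sub_zero (_ * z v 1), ← zero_mul (z v 0), ← h0, Finset.sum_mul, Finset.sum_mul,
      Finset.sum_mul, ← Finset.sum_sub_distrib]
    exact Finset.sum_congr rfl fun u _ => by ring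

/-- An edge exerts opposite forces on its ends, so the resultants, here purely radial, cancel in
total. -/
lemma sum_radialLoads_mul {z : V → Fin 2 → ℝ} (hz : ∀ v, z v 0 ^ 2 + z v 1 ^ 2 ≠ 0)
    {g : Sym2 V → ℝ} (hg : moments z g = 0) (a : Fin 2) :
    ∑ v, radialLoads z g v * z v a = 0 := by
  have h1 : ∑ v, radialLoads z g v * z v a = ∑ v, ∑ u, g s(u, v) * (z u a - z v a) :=
    Finset.sum_congr rfl fun v _ => (sum_mul_sub_eq_radialLoads hz hg v a).symm
  have h2 : ∑ v, ∑ u, g s(u, v) * (z u a - z v a) = -∑ v, ∑ u, g s(u, v) * (z u a - z v a) := by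
    conv_lhs => rw [Finset.sum_comm]
    simp only [← Finset.sum_neg_distrib]
    refine Finset.sum_congr rfl fun v _ => Finset.sum_congr rfl fun u _ => ?_
    rw [show s(v, u) = s(u, v) from Sym2.eq_swap]
    ring
  rw [h1]
  linarith

lemma radialLoads_eq_zero (z : V → Fin 2 → ℝ) {F : Set (Sym2 V)} {g : Sym2 V → ℝ}
    (hg : ∀ e ∉ F, g e = 0) {v : V} (hv : v ∉ spanned F) : radialLoads z g v = 0 := by
  have : ∀ u, g s(u, v) = 0 := fun u => hg _ fun h => hv ⟨_, h, by simp⟩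
  simp [radialLoads, this]

lemma finrank_le_card_of_forall_eq_zero {M ι : Type*} [AddCommGroup M] [Module ℝ M] [Fintype ι]
    (W : Submodule ℝ M) (φ : M →ₗ[ℝ] (ι → ℝ)) (hφ : ∀ g ∈ W, φ g = 0 → g = 0) :
    Module.finrank ℝ W ≤ Fintype.card ι := by
  rw [← Module.finrank_fintype_fun_eq_card ℝ (η := ι)]
  refine LinearMap.finrank_le_finrank_of_injective (f := φ.domRestrict W) ?_
  rw [← LinearMap.ker_eq_bot, LinearMap.ker_eq_bot']
  exact fun g hg => Subtype.ext (hφ g g.2 hg)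

/-- An independent generic framework satisfies the `gOne` counts. -/
theorem IsGeneric.le_gOne_of_isIndependent {G : SimpleGraph V} {χ : V → Option C} {r : C → ℝ}
    {p : V → EuclideanSpace ℝ (Fin 2)} (hp : IsFramework (d := 1) χ r p)
    (hgen : IsGeneric (d := 1) χ r p) (hind : IsIndependent (d := 1) G χ p)
    {F : Set (Sym2 V)} (hF : F ⊆ G.edgeSet) (hne : F.Nonempty) : (F.ncard : ℤ) ≤ gOne χ F := by
  classical
  rw [IsIndependent, rigidityMatrix_eq, linearIndependent_row_iff] at hind
  set z : V → Fin 2 → ℝ := fun v a => p v a with hzdef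
  have hz : ∀ v, z v 0 ^ 2 + z v 1 ^ 2 ≠ 0 := hp.sq_add_sq_ne_zero
  have hsupp : ∀ g : F → ℝ, ∀ e ∉ F, extendWeights F g e = 0 := fun g e he => dif_neg he
  let W := LinearMap.ker ((moments z).comp (extendWeights F))
  -- Loads vanish outside V(F), so zero totals on its colours already make the weights a full row
  -- dependency.
  have hinj : ∀ g ∈ W, (∀ c, (∃ v ∈ spanned F, χ v = some c) →
      ∑ v, (if χ v = some c then radialLoads z (extendWeights F g) v else 0) = 0) → g = 0 := by
    intro g hg hcol
    have h1 := hind (fun u v => extendWeights F g s(u, v)) (radialLoads z (extendWeights F g))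
      (fun u v => by rw [Sym2.eq_swap]) (fun u v huv => hsupp g _ fun h => huv (hF h))
      (sum_mul_sub_eq_radialLoads hz hg) (fun c => ?_)
    · ext ⟨e, he⟩
      induction e using Sym2.ind with
      | _ u v => simpa [extendWeights, he] using h1.1 u v
    · by_cases hc : ∃ v ∈ spanned F, χ v = some c
      · exact hcol c hc
      · refine Finset.sum_eq_zero fun v _ => ?_
        split_ifs with hv
        · exact radialLoads_eq_zero z (hsupp g) fun h => hc ⟨v, h, hv⟩
        · rfl
  have hrank := LinearMap.finrank_range_add_finrank_ker ((moments z).comp (extendWeights F))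
  have hrange : Module.finrank ℝ (LinearMap.range ((moments z).comp (extendWeights F))) ≤
      graphicRank F := by
    refine Submodule.finrank_mono ?_
    rintro _ ⟨g, rfl⟩
    exact moments_mem_cutSpace z (hsupp g)
  have hcolours : Module.finrank ℝ W ≤ numColoursOf χ F := by
    let φ : (F → ℝ) →ₗ[ℝ] ({c : C | ∃ v ∈ spanned F, χ v = some c} → ℝ) :=
      { toFun := fun g c =>
          ∑ v, if χ v = some c.1 then radialLoads z (extendWeights F g) v else 0
        map_add' := fun g g' => by
          ext c
          simp only [map_add, Pi.add_apply, ← Finset.sum_add_distrib]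
          exact Finset.sum_congr rfl fun v _ => by split_ifs <;> simp
        map_smul' := fun t g => by
          ext c
          simp only [map_smul, Pi.smul_apply, smul_eq_mul, Finset.mul_sum, RingHom.id_apply]
          exact Finset.sum_congr rfl fun v _ => by split_ifs <;> simp }
    have h1 := finrank_le_card_of_forall_eq_zero W φ fun g hg h =>
      hinj g hg fun c hc => congrFun h ⟨c, hc⟩
    rwa [← Nat.card_eq_fintype_card, Nat.card_coe_set_eq] at h1
  have hvertices : Module.finrank ℝ W + 2 ≤ (spanned F).ncard := by
    obtain ⟨e, he⟩ := hne
    induction e using Sym2.ind with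
    | _ x y =>
    have hxy : x ≠ y := (hF he : G.Adj x y).ne
    have hx : x ∈ spanned F := ⟨_, he, by simp⟩
    have hy : y ∈ spanned F := ⟨_, he, by simp⟩
    have hcross : z x 0 * z y 1 - z x 1 * z y 0 ≠ 0 := hgen.cross_ne hxy
    -- Since `p x` and `p y` are independent, the vector equation for the loads determines those at
    -- `x` and `y` from the rest; two coordinates can be dropped.
    let T : Set V := (spanned F \ {x}) \ {y}
    have h1 := finrank_le_card_of_forall_eq_zero W ((LinearMap.funLeft ℝ ℝ ((↑) : T → V)).comp
      ((radialLoads z).comp (extendWeights F))) fun g hg h => by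
        have h0 : ∀ v, v ≠ x → v ≠ y → radialLoads z (extendWeights F g) v = 0 := by
          intro v hvx hvy
          by_cases hv : v ∈ spanned F
          · exact congrFun h ⟨v, ⟨hv, hvx⟩, hvy⟩
          · exact radialLoads_eq_zero z (hsupp g) hv
        have hsum : ∀ a, radialLoads z (extendWeights F g) x * z x a +
            radialLoads z (extendWeights F g) y * z y a = 0 := by
          intro a
          rw [← sum_radialLoads_mul hz hg a, Fintype.sum_eq_add x y hxy]
          rintro v ⟨hvx, hvy⟩
          rw [h0 v hvx hvy, zero_mul]
        have hlx : radialLoads z (extendWeights F g) x = 0 :=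
          (mul_eq_zero.1 (by linear_combination z y 1 * hsum 0 - z y 0 * hsum 1 :
            radialLoads z (extendWeights F g) x * (z x 0 * z y 1 - z x 1 * z y 0) = 0)).resolve_right
            hcross
        have hly : radialLoads z (extendWeights F g) y = 0 :=
          (mul_eq_zero.1 (by linear_combination z x 0 * hsum 1 - z x 1 * hsum 0 :
            radialLoads z (extendWeights F g) y * (z x 0 * z y 1 - z x 1 * z y 0) = 0)).resolve_right
            hcross
        refine hinj g hg fun c _ => Finset.sum_eq_zero fun v _ => ?_
        have hv : radialLoads z (extendWeights F g) v = 0 := by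
          by_cases hvx : v = x
          · rw [hvx, hlx]
          · by_cases hvy : v = y
            · rw [hvy, hly]
            · exact h0 v hvx hvy
        rw [hv, ite_self]
    rw [← Nat.card_eq_fintype_card, Nat.card_coe_set_eq] at h1
    have h2 := Set.ncard_sdiff_singleton_add_one hx
    have h3 : T.ncard + 1 = _ := Set.ncard_sdiff_singleton_add_one (s := spanned F \ {x}) ⟨hy, hxy.symm⟩
    omega
  rw [Module.finrank_fintype_fun_eq_card, ← Nat.card_eq_fintype_card, Nat.card_coe_set_eq] at hrank
  rw [gOne_eq]
  change _ + Module.finrank ℝ W = _ at hrank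
  omega

end Necessity
end VariableSpheres

theorem theorem1 {V C : Type*} [Fintype V] [DecidableEq V] [Fintype C] [DecidableEq C]
    (G : SimpleGraph V) (χ : V → Option C) (r : C → ℝ) (p : V → EuclideanSpace ℝ (Fin 2))
    (hp : VariableSpheres.IsFramework (d := 1) χ r p)
    (hgen : VariableSpheres.IsGeneric (d := 1) χ r p) :
    VariableSpheres.IsIsostatic (d := 1) G χ p ↔ VariableSpheres.IsGOneTight G χ := by
  classical
  have hrigid : VariableSpheres.IsIndependent (d := 1) G χ p →
      (VariableSpheres.IsInfinitesimallyRigid (d := 1) G χ p ↔ (G.edgeSet.ncard : ℤ) =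
        (Fintype.card V : ℤ) - 1 +
          min (VariableSpheres.numColours χ : ℤ) ((Fintype.card V : ℤ) - 2)) := by
    intro hind
    have : Fintype G.edgeSet := Fintype.ofFinite _
    -- The rank equals the number of rows |E| + |V|; subtracting |V| turns the rank condition into
    -- the edge count.
    have hrank := LinearIndependent.rank_matrix hind
    rw [Fintype.card_sum, ← Nat.card_eq_fintype_card (α := G.edgeSet)] at hrank
    rw [VariableSpheres.IsInfinitesimallyRigid, hrank, ← Nat.card_coe_set_eq]
    push_cast
    norm_num
    constructor <;> intro h <;> linarith
  constructor
  · rintro ⟨hind, hrig⟩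
    exact ⟨(hrigid hind).1 hrig, fun F hF hne => hgen.le_gOne_of_isIndependent hp hind hF hne⟩
  · rintro ⟨hcard, hsparse⟩
    have hind := hgen.isIndependent_of_le_gOne hsparse
    exact ⟨hind, (hrigid hind).2 hcard⟩
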